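/- Let $B=(V,E,\preceq)$ be a properly ordered Bratteli diagram: finite non-empty vertex sets $V_0=\{v_0\},V_1,V_2,\dots$; finite sets $E_n$ ($n\ge 1$) of edges from $V_{n-1}$ to $V_n$, each vertex of $V_{n-1}$ being the initial point and each vertex of $V_n$ the end-point of some edge of $E_n$; a partial order on edges in which two edges of the same $E_n$ are comparable iff they have the same end-point; and exactly one infinite path all of whose edges are maximal and exactly one all of whose edges are minimal. Let $X$ be the space of infinite paths $x=(x_1,x_2,\dots)$ from $v_0$, with the topology generated by cylinders, and let $T:X\to X$ be the Vershik map. It sends the maximal path to the minimal one; for any other $x$, if $n$ is the least index for which $x_n$ is not maximal, it replaces $x_n$ by its successor and $(x_1,\dots,x_{n-1})$ by the minimal path from $v_0$ to the initial point of that successor. Let $d\ge 2$ and assume that $B$ is * *proper of rank $d$*: each vertex of $V_1$ receives exactly one edge; and for every $n\ge2$, every vertex of $V_{n-1}$ is joined to every vertex of $V_n$ by at least one edge, $\#V_n=d$, and all maximal edges of $E_n$ start in the same vertex; * *of Toeplitz type*: for every $n\ge 1$ each vertex of $V_n$ is the end-point of exactly $q_n$ edges of $E_n$. Put $p_n=q_1\cdots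 q_n$ and $q_{m,n}=q_{m+1}\cdots q_n$. Let $\tau_n(x)\in V_n$ be the vertex of level $n$ on $x$. Finite paths from level $m$ to level $n$ with a common end-point are ordered by comparing their edges at the last level at which they differ. Let $\bar s_{m,n}(x)$ be the number of paths from level $m$ to level $n$ that end at $\tau_n(x)$ and are strictly bigger than $(x_{m+1},\dots,x_n)$. For $t_1\in V_m$, $t_2\in V_n$ let $\bar S_{m,n}(t_1,t_2)=\{\bar s_{m,n}(x) : x\in X,\ \tau_m(x)=t_1,\ \tau_n(x)=t_2\}$. Let $\mu$ be a $T$-invariant Borel probability measure on $X$. A complex number $\lambda$ is an eigenvalue for $\mu$ if $f\circ T=\lambda f$ $\mu$-a.e. for some nonzero $f\in L^2(X,\mu)$; it is a continuous eigenvalue if $f\circ T=\lambda f$ for some continuous $f:X\to\mathbb C$, $f\ne0$; and it is a non-continuous eigenvalue for $\mu$ if it is an eigenvalue for $\mu$ but not a continuous eigenvalue. Let $\lambda=\exp(2i\pi a/b)$, where $a,b$ are coprime integers with $b/\gcd(b,p_n)=d$ for all large $n$. Then $\lambda$ is a non-continuous eigenvalue for $\mu$ if and only if $$\frac{1}{q_{m,n}}\Bigl|\sum_{s\in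 \bar S_{m,n}(t_1,t_2)}\lambda^{-p_m s}\Bigr|\longrightarrow \frac1d\qquad (m,n\to\infty,\ m<n)$$ uniformly, that is, for every $\varepsilon>0$ there is $N$ such that for all $n>m\ge N$ and all $t_1\in V_m$, $t_2\in V_n$ the left-hand side differs from $1/d$ by less than $\varepsilon$. If $\lambda$ is an eigenvalue for $\mu$, then $\mu$ is the only $T$-invariant Borel probability measure on $X$, and $\lim_{n\to\infty}\mu(\tau_n=t_n)=1/d$ for every choice of vertices $t_n\in V_n$; in particular, if the levels are identified with $\{1,\dots,d\}$, then $\lim_{n\to\infty}\mu(\tau_n=t)=1/d$ for each $t\in\{1,\dots,d\}$. -/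

import Mathlib

open Filter Topology MeasureTheory

/-- An ordered Bratteli diagram. `V n` is the (finite) set of vertices of level `n`, with `V 0` a
single vertex, and `E n` is the (finite) set of edges joining `V n` to `V (n + 1)` (so `E n` is
what is usually written `E_{n+1}`). Two edges are comparable iff they have the same end-point. -/
structure OrderedBratteliDiagram where
  V : ℕ → Type
  E : ℕ → Type
  finite_V : ∀ n, Finite (V n)
  finite_E : ∀ n, Finite (E n)
  card_V_zero : Nat.card (V 0) = 1
  src : ∀ {n}, E n → V n
  tgt : ∀ {n}, E n → V (n + 1)
  src_surjective : ∀ n, Function.Surjective (src : E n → V n)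
  tgt_surjective : ∀ n, Function.Surjective (tgt : E n → V (n + 1))
  order : ∀ n, PartialOrder (E n)
  comparable_iff : ∀ {n} (e f : E n), (e ≤ f ∨ f ≤ e) ↔ tgt e = tgt f

namespace OrderedBratteliDiagram

attribute [instance] OrderedBratteliDiagram.finite_V OrderedBratteliDiagram.finite_E
  OrderedBratteliDiagram.order

variable (B : OrderedBratteliDiagram)

/-! ### Infinite paths -/

/-- The space `X_B` of infinite paths starting at the vertex of level `0`. -/
def PathSpace : Type :=
  {x : ∀ n, B.E n // ∀ n, B.tgt (x n) = B.src (x (n + 1))}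

/-- The topology generated by cylinders: the one induced by the product of discrete topologies. -/
instance : TopologicalSpace B.PathSpace :=
  TopologicalSpace.induced Subtype.val (@Pi.topologicalSpace ℕ B.E fun _ => ⊥)

instance : MeasurableSpace B.PathSpace := borel _

instance : BorelSpace B.PathSpace := ⟨rfl⟩

variable {B}

/-- `τ_n(x)`: the vertex of level `n` through which `x` passes, that is, the tower of the
`n`-th Kakutani-Rohlin partition that contains `x`. -/
def PathSpace.tower (n : ℕ) (x : B.PathSpace) : B.V n := B.src (x.1 n)

/-- All edges of the path are maximal. -/
def PathSpace.IsMaxPath (x : B.PathSpace) : Prop := ∀ n, IsMax (x.1 n)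

/-- All edges of the path are minimal. -/
def PathSpace.IsMinPath (x : B.PathSpace) : Prop := ∀ n, IsMin (x.1 n)

variable (B)

/-- There are a unique maximal and a unique minimal infinite path. -/
def IsProperlyOrdered : Prop :=
  (∃! x : B.PathSpace, x.IsMaxPath) ∧ (∃! x : B.PathSpace, x.IsMinPath)

/-! ### The Vershik map -/

variable {B}

/-- `y` is the image of the non maximal path `x`: if `n` is the first level at which `x` is not
maximal, then `y n` is the successor of `x n`, the edges of `y` before level `n` are minimal, and
`y` agrees with `x` after level `n`. -/
def IsSuccPath (x y : B.PathSpace) : Prop :=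
  ∃ n, (∀ i < n, IsMax (x.1 i)) ∧ ¬ IsMax (x.1 n) ∧ x.1 n ⋖ y.1 n ∧
    (∀ i < n, IsMin (y.1 i)) ∧ ∀ i, n < i → y.1 i = x.1 i

theorem exists_isMin_edge {n : ℕ} (v : B.V (n + 1)) : ∃ e : B.E n, B.tgt e = v ∧ IsMin e := by
  obtain ⟨e, he⟩ := B.tgt_surjective n v
  obtain ⟨f, hfe, hf⟩ := (Set.toFinite (Set.Iic e)).exists_le_minimal (a := e) (by simp)
  refine ⟨f, ?_, ?_⟩
  · rw [← he]
    exact (B.comparable_iff f e).1 (Or.inl hfe)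
  · intro g hg
    exact hf.2 (le_trans hg hfe) hg

theorem exists_extend_min (n : ℕ) (a : ∀ i, B.E i)
    (ha : ∀ i, n ≤ i → B.tgt (a i) = B.src (a (i + 1))) :
    ∃ y : B.PathSpace, (∀ i, n ≤ i → y.1 i = a i) ∧ ∀ i < n, IsMin (y.1 i) := by
  induction n generalizing a with
  | zero => exact ⟨⟨a, fun i => ha i (Nat.zero_le i)⟩, by simp⟩
  | succ n ih =>
    obtain ⟨e, het, hem⟩ := exists_isMin_edge (B.src (a (n + 1)))
    obtain ⟨y, hy1, hy2⟩ := ih (Function.update a n e) (by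
      intro i hi
      rw [Function.update_of_ne (show i + 1 ≠ n by omega)]
      rcases Nat.eq_or_lt_of_le hi with h | h
      · subst h
        rw [Function.update_self, het]
      · rw [Function.update_of_ne (show i ≠ n by omega)]
        exact ha i h)
    refine ⟨y, fun i hi => ?_, fun i hi => ?_⟩
    · rw [hy1 i (by omega), Function.update_of_ne (show i ≠ n by omega)]
    · rcases Nat.eq_or_lt_of_le (Nat.lt_succ_iff.1 hi) with h | h
      · subst h
        rw [hy1 i le_rfl, Function.update_self]
        exact hem
      · exact hy2 i h

theorem exists_isSuccPath (x : B.PathSpace) (hx : ¬ x.IsMaxPath) : ∃ y, IsSuccPath x y := by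
  classical
  have hx' : ∃ n, ¬ IsMax (x.1 n) := not_forall.1 hx
  set n := Nat.find hx' with hn
  have hmax : ∀ i < n, IsMax (x.1 i) := fun i hi => not_not.1 (Nat.find_min hx' hi)
  have hnm : ¬ IsMax (x.1 n) := Nat.find_spec hx'
  obtain ⟨e, he⟩ := exists_covBy_of_wellFoundedLT hnm
  obtain ⟨y, hy1, hy2⟩ := exists_extend_min n (Function.update x.1 n e) (by
    intro i hi
    rw [Function.update_of_ne (show i + 1 ≠ n by omega), ← x.2 i]
    rcases Nat.eq_or_lt_of_le hi with h | h
    · rw [← h, Function.update_self]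
      exact ((B.comparable_iff _ _).1 (Or.inl he.le)).symm
    · rw [Function.update_of_ne (show i ≠ n by omega)])
  refine ⟨y, n, hmax, hnm, ?_, hy2, fun i hi => ?_⟩
  · rw [hy1 n le_rfl, Function.update_self]
    exact he
  · rw [hy1 i hi.le, Function.update_of_ne (show i ≠ n by omega)]

theorem isMin_edge_unique {n : ℕ} {e f : B.E n} (h : B.tgt e = B.tgt f) (he : IsMin e)
    (hf : IsMin f) : e = f := by
  rcases (B.comparable_iff e f).2 h with h' | h'
  · exact (hf.eq_of_ge h').symm
  · exact he.eq_of_ge h'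

theorem covBy_edge_unique {n : ℕ} {e f g : B.E n} (hf : e ⋖ f) (hg : e ⋖ g) : f = g := by
  have h : B.tgt f = B.tgt g :=
    ((B.comparable_iff _ _).1 (Or.inl hf.le)).symm.trans ((B.comparable_iff _ _).1 (Or.inl hg.le))
  rcases (B.comparable_iff f g).2 h with h' | h'
  · exact (hg.eq_or_eq hf.le h').resolve_left hf.lt.ne'
  · exact ((hf.eq_or_eq hg.le h').resolve_left hg.lt.ne').symm

/-- The successor of a non maximal path is unique, so the Vershik map below is well defined. -/
theorem isSuccPath_unique {x y z : B.PathSpace} (hy : IsSuccPath x y) (hz : IsSuccPath x z) :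
    y = z := by
  obtain ⟨n, h1, h2, h3, h4, h5⟩ := hy
  obtain ⟨m, k1, k2, k3, k4, k5⟩ := hz
  obtain rfl : n = m := by
    rcases lt_trichotomy n m with h | h | h
    · exact absurd (k1 n h) h2
    · exact h
    · exact absurd (h1 m h) k2
  have key : ∀ j i, i + j = n → y.1 i = z.1 i := by
    intro j
    induction j with
    | zero =>
      rintro i rfl
      exact covBy_edge_unique h3 k3
    | succ j ih =>
      intro i hi
      refine isMin_edge_unique ?_ (h4 i (by omega)) (k4 i (by omega))
      rw [y.2 i, z.2 i, ih (i + 1) (by omega)]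
  refine Subtype.ext (funext fun i => ?_)
  rcases le_or_gt i n with h | h
  · exact key (n - i) i (by omega)
  · rw [h5 i h, k5 i h]

open Classical in
/-- The Vershik map of a properly ordered Bratteli diagram: a non maximal path is sent to its
successor, and the maximal path to the minimal one. -/
noncomputable def vershik (hB : B.IsProperlyOrdered) (x : B.PathSpace) : B.PathSpace :=
  if hx : x.IsMaxPath then hB.2.choose else (exists_isSuccPath x hx).choose

theorem vershik_of_isMaxPath (hB : B.IsProperlyOrdered) {x : B.PathSpace} (hx : x.IsMaxPath) :
    (vershik hB x).IsMinPath := by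
  rw [vershik, dif_pos hx]
  exact hB.2.choose_spec.1

theorem vershik_of_not_isMaxPath (hB : B.IsProperlyOrdered) {x : B.PathSpace}
    (hx : ¬ x.IsMaxPath) : IsSuccPath x (vershik hB x) := by
  rw [vershik, dif_neg hx]
  exact (exists_isSuccPath x hx).choose_spec

variable (B)

/-! ### Proper diagrams of Toeplitz type -/

/-- Conditions (H1)-(H4) with `d` vertices per level. -/
structure IsProper (d : ℕ) : Prop where
  /-- every vertex of level `1` receives exactly one edge -/
  h1 : ∀ t : B.V 1, Nat.card {e : B.E 0 // B.tgt e = t} = 1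
  /-- the incidence matrices between levels `n ≥ 1` and `n + 1` are positive -/
  h2 : ∀ n, 1 ≤ n → ∀ (t : B.V n) (t' : B.V (n + 1)), ∃ e : B.E n, B.src e = t ∧ B.tgt e = t'
  /-- every level from the second on has `d` vertices -/
  h3 : ∀ n, 2 ≤ n → Nat.card (B.V n) = d
  /-- all maximal edges between levels `n ≥ 1` and `n + 1` start in the same vertex -/
  h4 : ∀ n, 1 ≤ n → ∀ e f : B.E n, IsMax e → IsMax f → B.src e = B.src f

/-- The diagram is of Toeplitz type with characteristic sequence `(q n ; n ≥ 1)`: each vertex of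
level `n + 1` is the end-point of exactly `q (n + 1)` edges. -/
def IsToeplitz (q : ℕ → ℕ) : Prop :=
  ∀ n (t : B.V (n + 1)), Nat.card {e : B.E n // B.tgt e = t} = q (n + 1)

/-- `q_{m,n} = q_{m+1} ⋯ q_n`; in particular `p_n = q_{0,n}`. -/
def qProd (q : ℕ → ℕ) (m n : ℕ) : ℕ := ∏ i ∈ Finset.Ioc m n, q i

/-! ### Finite paths -/

/-- The finite paths from level `m` to level `n`, given by their vertices and edges. -/
@[ext]
structure FinPath (m n : ℕ) where
  v : ∀ i, m ≤ i → i ≤ n → B.V i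
  e : ∀ i, m ≤ i → i < n → B.E i
  src_e : ∀ i (hm : m ≤ i) (hn : i < n), B.src (e i hm hn) = v i hm hn.le
  tgt_e : ∀ i (hm : m ≤ i) (hn : i < n), B.tgt (e i hm hn) = v (i + 1) (hm.trans i.le_succ) hn

instance (m n : ℕ) : Finite (B.FinPath m n) := by
  let F : B.FinPath m n → (∀ i : Set.Icc m n, B.V i) × (∀ i : Set.Ico m n, B.E i) :=
    fun p => (fun i => p.v i i.2.1 i.2.2, fun i => p.e i i.2.1 i.2.2)
  refine Finite.of_injective F fun p p' h => ?_
  have hv := (Prod.ext_iff.1 h).1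
  have he := (Prod.ext_iff.1 h).2
  refine FinPath.ext ?_ ?_
  · funext i h1 h2
    exact congrFun hv ⟨i, h1, h2⟩
  · funext i h1 h2
    exact congrFun he ⟨i, h1, h2⟩

variable {B}

/-- The strict order induced on finite paths: at the last level where they differ, the edge of `p`
is smaller than the edge of `p'` (in particular they have the same end-point). -/
def FinPath.Lt {m n : ℕ} (p p' : B.FinPath m n) : Prop :=
  ∃ i, ∃ (hm : m ≤ i) (hn : i < n), p.e i hm hn < p'.e i hm hn ∧
    ∀ j (hj : i < j) (hjn : j < n), p.e j (hm.trans hj.le) hjn = p'.e j (hm.trans hj.le) hjn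

/-- The part of an infinite path between levels `m` and `n`. -/
def PathSpace.restrict (m n : ℕ) (x : B.PathSpace) : B.FinPath m n where
  v i _ _ := x.tower i
  e i _ _ := x.1 i
  src_e _ _ _ := rfl
  tgt_e i _ _ := x.2 i

/-- The number of paths from level `m` to level `n` which end at `τ_n(x)` and are strictly bigger
than the part of `x` between these levels. -/
noncomputable def PathSpace.suffix {m n : ℕ} (h : m ≤ n) (x : B.PathSpace) : ℕ :=
  Nat.card {p : B.FinPath m n // p.v n h le_rfl = x.tower n ∧ (x.restrict m n).Lt p}

/-- The set of the numbers `x.suffix` over the paths `x` passing through `t₁` and `t₂`. -/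
def suffixSet {m n : ℕ} (h : m ≤ n) (t₁ : B.V m) (t₂ : B.V n) : Set ℕ :=
  {s | ∃ x : B.PathSpace, x.tower m = t₁ ∧ x.tower n = t₂ ∧ x.suffix h = s}

theorem suffixSet_finite {m n : ℕ} (h : m ≤ n) (t₁ : B.V m) (t₂ : B.V n) :
    (suffixSet h t₁ t₂).Finite := by
  refine (Set.finite_Iic (Nat.card (B.FinPath m n))).subset ?_
  rintro s ⟨x, -, -, rfl⟩
  exact Finite.card_subtype_le _

/-- The sum of `lam ^ (-p_m s)` over `s` in the suffix set of `t₁` and `t₂`. -/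
noncomputable def suffixSum (q : ℕ → ℕ) (lam : ℂ) {m n : ℕ} (h : m ≤ n) (t₁ : B.V m)
    (t₂ : B.V n) : ℂ :=
  ∑ s ∈ (suffixSet_finite h t₁ t₂).toFinset, lam ^ (-((qProd q 0 m * s : ℕ) : ℤ))

end OrderedBratteliDiagram

/-! ### Eigenvalues -/

/-- `lam` is a continuous eigenvalue of `T`. -/
def IsContinuousEigenvalue {X : Type*} [TopologicalSpace X] (T : X → X) (lam : ℂ) : Prop :=
  ∃ f : X → ℂ, Continuous f ∧ f ≠ 0 ∧ ∀ x, f (T x) = lam * f x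

/-- `lam` is an eigenvalue of `T` with respect to `μ`, with an eigenfunction in `L²(μ)`. -/
def IsMeasurableEigenvalue {X : Type*} [MeasurableSpace X] (T : X → X) (μ : Measure X)
    (lam : ℂ) : Prop :=
  ∃ f : X → ℂ, MemLp f 2 μ ∧ ¬ f =ᵐ[μ] 0 ∧ ∀ᵐ x ∂μ, f (T x) = lam * f x

/-- `lam` is an eigenvalue with respect to `μ`, but not a continuous eigenvalue. -/
def IsNonContinuousEigenvalue {X : Type*} [TopologicalSpace X] [MeasurableSpace X] (T : X → X)
    (μ : Measure X) (lam : ℂ) : Prop :=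
  IsMeasurableEigenvalue T μ lam ∧ ¬ IsContinuousEigenvalue T lam

/-! Counted from the maximal one, the paths from level m to level n that end at t₂ have positions 0,
…, q_{m,n} - 1. The position is the number whose mixed-radix digits are the edge ranks, and it
equals the suffix count (`suffix_eq_index`). The Vershik map lowers the position in a tower of level
n by one until it is 0. Hence an invariant measure gives all floors of a tower the same mass, and an
eigenfunction should look like λ^{-j} c(t) at position j of tower t.

Suppose that λ is an eigenvalue. As λ is a root of unity, there is an eigenfunction with values in 0
and the roots of unity of some fixed order (`exists_root_valued`). Having finitely many values, it
equals such a towerwise function outside a small set, at every high level (`exists_towerwise`).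
Comparison of levels m and n gives c(vertex at position s) = c'(t₂) ω^s for most s, where ω =
λ^{-p_m} is a primitive d-th root of unity. There are d vertices and d powers of ω, so vertices
correspond to residue classes mod d. The positions of t₁ under t₂ thus form one residue class up to
few errors, and their exponential sum has modulus close to q_{m,n}/d
(`suffixSumsConverge_of_isMeasurableEigenvalue`).

Conversely, the function λ^{-j} on one tower of mass at least 1/d is an approximate eigenvector. Its
inner product with a similar function of a fixed level is, in modulus, a normalized suffix sum times
that mass, hence bounded below, and a weak limit is a true eigenvector
(`isMeasurableEigenvalue_of_suffixSumsConverge`). It is never continuous: all points of position 0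
are close to the maximal path, and T^{p_n} returns that path to position 0, while λ^{p_n} stays away
from 1 (`not_isContinuousEigenvalue`).

Finally, a suffix sum is at most the number of paths counted, so convergence forces every high tower
to have mass at least about 1/d. As there are d towers, all masses tend to 1/d, and this determines
the measure (`invariant_unique`). -/

namespace OrderedBratteliDiagram

variable {B : OrderedBratteliDiagram} {q : ℕ → ℕ}

/-! ### Ranks of edges -/

/-- The number of edges that are strictly bigger than `e`. -/
noncomputable def edgeRank {n : ℕ} (e : B.E n) : ℕ := Nat.card {f : B.E n // e < f}

theorem tgt_eq_of_le {n : ℕ} {e f : B.E n} (h : e ≤ f) : B.tgt e = B.tgt f :=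
  (B.comparable_iff e f).1 (Or.inl h)

theorem edgeRank_lt (hq : B.IsToeplitz q) {n : ℕ} (e : B.E n) : edgeRank e < q (n + 1) := by
  rw [← hq n (B.tgt e)]
  refine Set.ncard_lt_ncard (s := {f | e < f}) (t := {f | B.tgt f = B.tgt e}) ?_
  exact ⟨fun f hf => (tgt_eq_of_le (le_of_lt hf)).symm, fun h => lt_irrefl e (h rfl)⟩

theorem edgeRank_strictAnti {n : ℕ} {e f : B.E n} (h : e < f) : edgeRank f < edgeRank e := by
  refine Set.ncard_lt_ncard (s := {g | f < g}) (t := {g | e < g}) ?_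
  exact ⟨fun g hg => h.trans hg, fun h' => lt_irrefl f (h' h)⟩

theorem lt_of_edgeRank_lt {n : ℕ} {e f : B.E n} (h : B.tgt e = B.tgt f)
    (hr : edgeRank f < edgeRank e) : e < f := by
  rcases (B.comparable_iff e f).2 h with h' | h'
  · exact lt_of_le_of_ne h' (by rintro rfl; exact lt_irrefl _ hr)
  · rcases h'.eq_or_lt with rfl | h''
    · exact absurd hr (lt_irrefl _)
    · exact absurd hr (edgeRank_strictAnti h'').asymm

theorem edgeRank_inj {n : ℕ} {e f : B.E n} (h : B.tgt e = B.tgt f)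
    (hr : edgeRank e = edgeRank f) : e = f := by
  rcases (B.comparable_iff e f).2 h with h' | h'
  · exact h'.eq_of_not_lt fun hlt => (edgeRank_strictAnti hlt).ne' hr
  · exact (h'.eq_of_not_lt fun hlt => (edgeRank_strictAnti hlt).ne hr).symm

/-- The ranks inject the `q (n + 1)` edges ending at `v` into a set with as many elements. -/
theorem exists_edgeRank_eq (hq : B.IsToeplitz q) {n k : ℕ} (v : B.V (n + 1))
    (hk : k < q (n + 1)) : ∃ e : B.E n, B.tgt e = v ∧ edgeRank e = k := by
  have hbij : Function.Bijective
      (fun e : {e : B.E n // B.tgt e = v} => (⟨edgeRank e.1, edgeRank_lt hq e.1⟩ : Fin (q (n + 1)))) := by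
    rw [Nat.bijective_iff_injective_and_card]
    refine ⟨fun e f h => Subtype.ext (edgeRank_inj (e.2.trans f.2.symm) ?_), ?_⟩
    · exact congrArg Fin.val h
    · rw [hq n v, Nat.card_fin]
  obtain ⟨e, he⟩ := hbij.2 ⟨k, hk⟩
  exact ⟨e.1, e.2, congrArg Fin.val he⟩

theorem edgeRank_eq_zero_iff {n : ℕ} {e : B.E n} : edgeRank e = 0 ↔ IsMax e := by
  rw [edgeRank, Finite.card_eq_zero_iff, isMax_iff_forall_not_lt]
  exact ⟨fun h _ hf => h.false ⟨_, hf⟩, fun h => ⟨fun f => h f.1 f.2⟩⟩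

theorem edgeRank_of_isMin (hq : B.IsToeplitz q) {n : ℕ} {e : B.E n} (he : IsMin e) :
    edgeRank e + 1 = q (n + 1) := by
  have h0 := edgeRank_lt hq e
  obtain ⟨f, hf, hr⟩ := exists_edgeRank_eq hq (k := q (n + 1) - 1) (B.tgt e) (by omega)
  by_contra hne
  exact he.not_lt (lt_of_edgeRank_lt hf (by omega))

theorem edgeRank_of_covBy (hq : B.IsToeplitz q) {n : ℕ} {e f : B.E n} (h : e ⋖ f) :
    edgeRank e = edgeRank f + 1 := by
  by_contra hne
  have h1 := edgeRank_strictAnti h.lt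
  have h2 := edgeRank_lt hq e
  obtain ⟨g, hg, hr⟩ := exists_edgeRank_eq hq (k := edgeRank f + 1) (B.tgt e) (by omega)
  exact h.2 (lt_of_edgeRank_lt hg.symm (by omega))
    (lt_of_edgeRank_lt (hg.trans (tgt_eq_of_le h.le)) (by omega))

instance nonempty_V (n : ℕ) : Nonempty (B.V n) := by
  induction n with
  | zero => exact (Nat.card_pos_iff.1 (by rw [B.card_V_zero]; exact one_pos)).1
  | succ n ih => exact ⟨B.tgt (B.src_surjective n ih.some).choose⟩

theorem IsToeplitz.pos (hq : B.IsToeplitz q) (n : ℕ) : 0 < q (n + 1) :=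
  (Nat.zero_le _).trans_lt
    (edgeRank_lt hq (B.tgt_surjective n (nonempty_V (n + 1)).some).choose)

/-! ### Products of the characteristic sequence -/

@[simp] theorem qProd_self (q : ℕ → ℕ) (n : ℕ) : qProd q n n = 1 := by simp [qProd]

theorem qProd_succ (q : ℕ → ℕ) {m n : ℕ} (h : m ≤ n) :
    qProd q m (n + 1) = qProd q m n * q (n + 1) :=
  Finset.prod_Ioc_succ_top (by omega) _

theorem qProd_mul (q : ℕ → ℕ) {m k n : ℕ} (h : m ≤ k) (h' : k ≤ n) :
    qProd q m k * qProd q k n = qProd q m n :=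
  Finset.prod_Ioc_consecutive _ h h'

theorem IsToeplitz.qProd_pos (hq : B.IsToeplitz q) (m n : ℕ) : 0 < qProd q m n := by
  refine Finset.prod_pos fun i hi => ?_
  obtain ⟨j, rfl⟩ : ∃ j, i = j + 1 := ⟨i - 1, by have := (Finset.mem_Ioc.1 hi).1; omega⟩
  exact hq.pos j

/-! ### Positions of paths -/

theorem exists_extend (m : ℕ) (a : ∀ i, B.E i)
    (ha : ∀ i, m ≤ i → B.tgt (a i) = B.src (a (i + 1))) :
    ∃ y : B.PathSpace, ∀ i, m ≤ i → y.1 i = a i :=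
  (exists_extend_min m a ha).imp fun _ h => h.1

theorem exists_tower_eq (n : ℕ) (t : B.V n) : ∃ x : B.PathSpace, x.tower n = t := by
  classical
  choose g hg using fun i => B.src_surjective i
  let u : ∀ i, B.V i := Function.update (fun i => (nonempty_V i).some) n t
  -- Only the vertices from level `n` on matter: below it `v` is arbitrary, since `exists_extend`
  -- refills those levels with edges of its own.
  let v : ∀ i, B.V i := fun i =>
    Nat.rec (u 0) (fun i v => if i + 1 ≤ n then u (i + 1) else B.tgt (g i v)) i
  have hv : v n = t := by
    have hu : u n = t := Function.update_self ..
    cases n with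
    | zero => exact hu
    | succ n => exact (if_pos le_rfl).trans hu
  obtain ⟨y, hy⟩ := exists_extend n (fun i => g i (v i)) (by
    intro i hi
    rw [hg]
    exact (if_neg (by omega)).symm)
  exact ⟨y, by rw [PathSpace.tower, hy n le_rfl, hg, hv]⟩

/-- The position of the part of `x` between levels `m` and `n` among the paths with the same
end-point, counted from the maximal one. -/
noncomputable def PathSpace.index (q : ℕ → ℕ) (m n : ℕ) (x : B.PathSpace) : ℕ :=
  ∑ i ∈ Finset.Ico m n, qProd q m i * edgeRank (x.1 i)

namespace PathSpace

@[simp] theorem index_self (q : ℕ → ℕ) (n : ℕ) (x : B.PathSpace) : x.index q n n = 0 := by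
  simp [index]

theorem index_succ (q : ℕ → ℕ) {m n : ℕ} (h : m ≤ n) (x : B.PathSpace) :
    x.index q m (n + 1) = x.index q m n + qProd q m n * edgeRank (x.1 n) :=
  Finset.sum_Ico_succ_top h _

theorem index_add (q : ℕ → ℕ) {m k n : ℕ} (h : m ≤ k) (h' : k ≤ n) (x : B.PathSpace) :
    x.index q m n = x.index q m k + qProd q m k * x.index q k n := by
  rw [index, ← Finset.sum_Ico_consecutive _ h h', index, index, Finset.mul_sum]
  congr 1
  refine Finset.sum_congr rfl fun i hi => ?_
  rw [← mul_assoc, qProd_mul q h (Finset.mem_Ico.1 hi).1]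

theorem index_congr (q : ℕ → ℕ) {m n : ℕ} {x y : B.PathSpace}
    (h : ∀ i, m ≤ i → i < n → x.1 i = y.1 i) : x.index q m n = y.index q m n :=
  Finset.sum_congr rfl fun i hi => by
    rw [h i (Finset.mem_Ico.1 hi).1 (Finset.mem_Ico.1 hi).2]

theorem index_lt (hq : B.IsToeplitz q) {m n : ℕ} (h : m ≤ n) (x : B.PathSpace) :
    x.index q m n < qProd q m n := by
  induction n, h using Nat.le_induction with
  | base => simp
  | succ n h ih =>
    rw [index_succ q h, qProd_succ q h]
    have := edgeRank_lt hq (x.1 n)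
    calc _ < qProd q m n + qProd q m n * edgeRank (x.1 n) := by gcongr
      _ = qProd q m n * (edgeRank (x.1 n) + 1) := by ring
      _ ≤ _ := by gcongr; omega

theorem tower_eq_of_edge_eq {n : ℕ} {x y : B.PathSpace} (h : x.1 n = y.1 n) :
    x.tower n = y.tower n := congrArg B.src h

theorem tower_succ_eq {n : ℕ} {x y : B.PathSpace} (h : x.1 n = y.1 n) :
    x.tower (n + 1) = y.tower (n + 1) := by
  rw [tower, tower, ← x.2 n, ← y.2 n, h]

theorem tgt_eq_of_tower_eq {n : ℕ} {x y : B.PathSpace} (h : x.tower (n + 1) = y.tower (n + 1)) :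
    B.tgt (x.1 n) = B.tgt (y.1 n) := by
  rw [x.2 n, y.2 n]; exact h

theorem edge_eq_of_index_eq (hq : B.IsToeplitz q) {m n : ℕ} (h : m ≤ n) {x y : B.PathSpace}
    (ht : x.tower n = y.tower n) (hi : x.index q m n = y.index q m n) {i : ℕ} (hm : m ≤ i)
    (hn : i < n) : x.1 i = y.1 i := by
  induction n, h using Nat.le_induction with
  | base => omega
  | succ n h ih =>
    rw [index_succ q h, index_succ q h] at hi
    have hx := index_lt hq h x
    have hy := index_lt hq h y
    have h1 : edgeRank (x.1 n) = edgeRank (y.1 n) := by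
      have := congrArg (· / qProd q m n) hi
      simpa [Nat.add_mul_div_left _ _ (hq.qProd_pos m n), Nat.div_eq_of_lt hx,
        Nat.div_eq_of_lt hy] using this
    have h2 := edgeRank_inj (tgt_eq_of_tower_eq ht) h1
    rcases (Nat.lt_succ_iff.1 hn).eq_or_lt with rfl | hlt
    · exact h2
    · refine ih (tower_eq_of_edge_eq h2) ?_ hlt
      rw [h1] at hi
      omega

theorem tower_eq_of_index_eq (hq : B.IsToeplitz q) {m n : ℕ} (h : m ≤ n) {x y : B.PathSpace}
    (ht : x.tower n = y.tower n) (hi : x.index q m n = y.index q m n) {k : ℕ} (hm : m ≤ k)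
    (hn : k ≤ n) : x.tower k = y.tower k := by
  rcases hn.eq_or_lt with rfl | hlt
  · exact ht
  · exact tower_eq_of_edge_eq (edge_eq_of_index_eq hq h ht hi hm hlt)

/-- Mixed-radix expansion: the quotient of `s` by `qProd q m n` selects the last edge, and the
remainder is treated by induction. -/
theorem exists_index_eq (hq : B.IsToeplitz q) {m n : ℕ} (h : m ≤ n) (x : B.PathSpace) {s : ℕ}
    (hs : s < qProd q m n) :
    ∃ y : B.PathSpace, (∀ i, n ≤ i → y.1 i = x.1 i) ∧ y.index q m n = s := by
  induction n, h using Nat.le_induction generalizing x s with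
  | base => exact ⟨x, fun _ _ => rfl, by simp at hs; simp [hs]⟩
  | succ n h ih =>
    rw [qProd_succ q h] at hs
    obtain ⟨e, het, her⟩ := exists_edgeRank_eq hq (k := s / qProd q m n) (B.tgt (x.1 n))
      (Nat.div_lt_of_lt_mul hs)
    obtain ⟨z, hz⟩ := exists_extend n (Function.update x.1 n e) (by
      intro i hi
      rw [Function.update_of_ne (show i + 1 ≠ n by omega), ← x.2 i]
      rcases Nat.eq_or_lt_of_le hi with h | h
      · rw [← h, Function.update_self, het]
      · rw [Function.update_of_ne (show i ≠ n by omega)])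
    obtain ⟨y, hy, hys⟩ := ih z (Nat.mod_lt s (hq.qProd_pos m n))
    refine ⟨y, fun i hi => ?_, ?_⟩
    · rw [hy i (by omega), hz i (by omega), Function.update_of_ne (show i ≠ n by omega)]
    · rw [index_succ q h, hys, hy n le_rfl, hz n le_rfl, Function.update_self, her, Nat.mod_add_div]

/-- All digits below level `i` together weigh less than one unit of the digit at `i`, so the order
of paths is the reversed order of positions. -/
theorem index_lt_index (hq : B.IsToeplitz q) {m n i : ℕ} (hm : m ≤ i) (hn : i < n)
    {x y : B.PathSpace} (hlt : x.1 i < y.1 i) (heq : ∀ j, i < j → j < n → x.1 j = y.1 j) :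
    y.index q m n < x.index q m n := by
  rw [index_add q (hm.trans i.le_succ) hn x, index_add q (hm.trans i.le_succ) hn y,
    index_congr q (fun j hj hj' => heq j hj hj'), index_succ q hm, index_succ q hm]
  have h1 := edgeRank_strictAnti hlt
  have h2 := index_lt hq hm y
  have h3 : qProd q m i * (edgeRank (y.1 i) + 1) ≤ qProd q m i * edgeRank (x.1 i) := by
    gcongr; omega
  rw [mul_add] at h3
  omega

theorem restrict_lt_iff (hq : B.IsToeplitz q) {m n : ℕ} (h : m ≤ n) {x y : B.PathSpace}
    (ht : x.tower n = y.tower n) :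
    (x.restrict m n).Lt (y.restrict m n) ↔ y.index q m n < x.index q m n := by
  constructor
  · rintro ⟨i, hm, hn, hlt, heq⟩
    exact index_lt_index hq hm hn hlt heq
  · intro hlt
    induction n, h using Nat.le_induction with
    | base => simp at hlt
    | succ n h ih =>
      have htgt := tgt_eq_of_tower_eq ht
      by_cases he : x.1 n = y.1 n
      · rw [index_succ q h, index_succ q h, he] at hlt
        obtain ⟨i, hm, hn, h1, h2⟩ := ih (tower_eq_of_edge_eq he) (by omega)
        refine ⟨i, hm, by omega, h1, fun j hj hjn => ?_⟩
        rcases (Nat.lt_succ_iff.1 hjn).eq_or_lt with rfl | hjn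
        · exact he
        · exact h2 j hj hjn
      · have hne : ∀ j, n < j → j < n + 1 → x.1 j = y.1 j := fun j _ _ => by omega
        rcases (B.comparable_iff _ _).2 htgt with h' | h'
        · exact ⟨n, h, n.lt_succ_self, lt_of_le_of_ne h' he, fun j _ _ => by omega⟩
        · exact absurd hlt (index_lt_index hq h n.lt_succ_self (lt_of_le_of_ne h' (Ne.symm he))
            (fun j _ _ => by omega)).asymm

theorem exists_restrict_eq {m n : ℕ} (h : m ≤ n) (x : B.PathSpace) (p : B.FinPath m n)
    (hp : p.v n h le_rfl = x.tower n) : ∃ y : B.PathSpace, y.restrict m n = p := by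
  classical
  obtain ⟨y, hy⟩ := exists_extend m
    (fun i => if hi : m ≤ i ∧ i < n then p.e i hi.1 hi.2 else x.1 i) (by
      intro i hi
      by_cases h1 : i < n
      · rw [dif_pos ⟨hi, h1⟩, p.tgt_e]
        by_cases h2 : i + 1 < n
        · rw [dif_pos ⟨by omega, h2⟩, p.src_e]
        · rw [dif_neg (by omega)]
          obtain rfl : n = i + 1 := by omega
          exact hp
      · rw [dif_neg (by omega), dif_neg (by omega), x.2])
  have he : ∀ i (hm : m ≤ i) (hn : i < n), y.1 i = p.e i hm hn := fun i hm hn => by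
    rw [hy i hm, dif_pos ⟨hm, hn⟩]
  refine ⟨y, FinPath.ext ?_ ?_⟩
  · funext i hm hn
    rcases hn.eq_or_lt with rfl | hlt
    · change B.src (y.1 i) = _
      rw [hy i hm, dif_neg (by omega)]
      exact hp.symm
    · change B.src (y.1 i) = _
      rw [he i hm hlt, p.src_e]
  · funext i hm hn
    exact he i hm hn

/-- The paths bigger than `x` are those of smaller position, one for each `s < x.index q m n`. -/
theorem suffix_eq_index (hq : B.IsToeplitz q) {m n : ℕ} (h : m ≤ n) (x : B.PathSpace) :
    x.suffix h = x.index q m n := by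
  have hlt : ∀ s : Fin (x.index q m n), s.1 < qProd q m n := fun s => s.2.trans (index_lt hq h x)
  choose y hy hys using fun s : Fin (x.index q m n) => exists_index_eq hq h x (hlt s)
  have hyt : ∀ s, (y s).tower n = x.tower n := fun s => tower_eq_of_edge_eq (hy s n le_rfl)
  have hbij : Function.Bijective (fun s => (⟨(y s).restrict m n, hyt s,
      (restrict_lt_iff hq h (hyt s).symm).2 ((hys s).trans_lt s.2)⟩ :
      {p : B.FinPath m n // p.v n h le_rfl = x.tower n ∧ (x.restrict m n).Lt p})) := by
    constructor
    · intro s s' hss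
      have he : (y s).restrict m n = (y s').restrict m n := congrArg (fun z => z.1) hss
      refine Fin.ext ?_
      rw [← hys s, ← hys s']
      exact index_congr q fun i hm hn => congrFun (congrFun (congrFun (congrArg FinPath.e he) i) hm) hn
    · rintro ⟨p, hp, hpl⟩
      obtain ⟨z, rfl⟩ := exists_restrict_eq h x p hp
      have hzt : z.tower n = x.tower n := hp
      have hz := (restrict_lt_iff hq h hzt.symm).1 hpl
      refine ⟨⟨_, hz⟩, Subtype.ext ?_⟩
      have h1 := hys ⟨_, hz⟩
      refine FinPath.ext ?_ ?_
      · funext i hm hn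
        exact tower_eq_of_index_eq hq h ((hyt _).trans hzt.symm) h1 hm hn
      · funext i hm hn
        exact edge_eq_of_index_eq hq h ((hyt _).trans hzt.symm) h1 hm hn
  rw [suffix, ← Nat.card_eq_of_bijective _ hbij, Nat.card_fin]

end PathSpace

end OrderedBratteliDiagram

namespace OrderedBratteliDiagram

variable {B : OrderedBratteliDiagram} {q : ℕ → ℕ}

/-! ### The vertex at a given position -/

theorem exists_tower_eq_index_eq (hq : B.IsToeplitz q) {m n s : ℕ} (h : m ≤ n) (t : B.V n)
    (hs : s < qProd q m n) : ∃ x : B.PathSpace, x.tower n = t ∧ x.index q m n = s := by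
  obtain ⟨x, rfl⟩ := exists_tower_eq n t
  obtain ⟨y, hy, hys⟩ := PathSpace.exists_index_eq hq h x hs
  exact ⟨y, PathSpace.tower_eq_of_edge_eq (hy n le_rfl), hys⟩

open Classical in
/-- The vertex of level `m` on the path from level `m` to `t` whose position is `s`. -/
noncomputable def vertexAt (q : ℕ → ℕ) (m : ℕ) {n : ℕ} (t : B.V n) (s : ℕ) : B.V m :=
  if h : ∃ x : B.PathSpace, x.tower n = t ∧ x.index q m n = s then h.choose.tower m
  else (nonempty_V m).some

theorem vertexAt_tower (hq : B.IsToeplitz q) {m n : ℕ} (h : m ≤ n) (x : B.PathSpace) :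
    vertexAt q m (x.tower n) (x.index q m n) = x.tower m := by
  have hx : ∃ y : B.PathSpace, y.tower n = x.tower n ∧ y.index q m n = x.index q m n :=
    ⟨x, rfl, rfl⟩
  rw [vertexAt, dif_pos hx]
  exact PathSpace.tower_eq_of_index_eq hq h hx.choose_spec.1 hx.choose_spec.2 le_rfl h

open Classical in
/-- The positions of the paths from `t₁` to `t₂`. -/
noncomputable def positions (q : ℕ → ℕ) {m n : ℕ} (t₁ : B.V m) (t₂ : B.V n) : Finset ℕ :=
  (Finset.range (qProd q m n)).filter fun s => vertexAt q m t₂ s = t₁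

theorem mem_positions {m n s : ℕ} {t₁ : B.V m} {t₂ : B.V n} :
    s ∈ positions q t₁ t₂ ↔ s < qProd q m n ∧ vertexAt q m t₂ s = t₁ := by
  simp [positions]

theorem positions_subset (q : ℕ → ℕ) {m n : ℕ} (t₁ : B.V m) (t₂ : B.V n) :
    positions q t₁ t₂ ⊆ Finset.range (qProd q m n) :=
  fun _ hs => Finset.mem_range.2 (mem_positions.1 hs).1

theorem card_positions_le (q : ℕ → ℕ) {m n : ℕ} (t₁ : B.V m) (t₂ : B.V n) :
    (positions q t₁ t₂).card ≤ qProd q m n :=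
  (Finset.card_le_card (positions_subset q t₁ t₂)).trans_eq (Finset.card_range _)

theorem toFinset_suffixSet (hq : B.IsToeplitz q) {m n : ℕ} (h : m ≤ n) (t₁ : B.V m)
    (t₂ : B.V n) : (suffixSet_finite h t₁ t₂).toFinset = positions q t₁ t₂ := by
  ext s
  rw [Set.Finite.mem_toFinset, mem_positions]
  constructor
  · rintro ⟨x, rfl, rfl, rfl⟩
    rw [PathSpace.suffix_eq_index hq h]
    exact ⟨PathSpace.index_lt hq h x, vertexAt_tower hq h x⟩
  · rintro ⟨hs, rfl⟩
    obtain ⟨x, rfl, rfl⟩ := exists_tower_eq_index_eq hq h t₂ hs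
    exact ⟨x, (vertexAt_tower hq h x).symm, rfl, PathSpace.suffix_eq_index hq h x⟩

theorem suffixSum_eq (hq : B.IsToeplitz q) (lam : ℂ) {m n : ℕ} (h : m ≤ n) (t₁ : B.V m)
    (t₂ : B.V n) :
    suffixSum q lam h t₁ t₂ = ∑ s ∈ positions q t₁ t₂, (lam ^ qProd q 0 m)⁻¹ ^ s := by
  rw [suffixSum, toFinset_suffixSet hq]
  refine Finset.sum_congr rfl fun s _ => ?_
  rw [zpow_neg, zpow_natCast, pow_mul, inv_pow]

noncomputable instance fintype_V (n : ℕ) : Fintype (B.V n) := Fintype.ofFinite _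

/-! ### Positions along the Vershik map -/

namespace PathSpace

theorem index_eq_zero_iff (hq : B.IsToeplitz q) {m n : ℕ} {x : B.PathSpace} :
    x.index q m n = 0 ↔ ∀ i, m ≤ i → i < n → IsMax (x.1 i) := by
  rw [index, Finset.sum_eq_zero_iff]
  refine ⟨fun h i hm hn => ?_, fun h i hi => ?_⟩
  · exact edgeRank_eq_zero_iff.1
      ((Nat.mul_eq_zero.1 (h i (Finset.mem_Ico.2 ⟨hm, hn⟩))).resolve_left (hq.qProd_pos m i).ne')
  · rw [edgeRank_eq_zero_iff.2 (h i (Finset.mem_Ico.1 hi).1 (Finset.mem_Ico.1 hi).2), mul_zero]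

theorem index_of_isMin (hq : B.IsToeplitz q) {m n : ℕ} (h : m ≤ n) {x : B.PathSpace}
    (hx : ∀ i, m ≤ i → i < n → IsMin (x.1 i)) : x.index q m n + 1 = qProd q m n := by
  induction n, h using Nat.le_induction with
  | base => simp
  | succ n h ih =>
    rw [index_succ q h, qProd_succ q h, ← edgeRank_of_isMin hq (hx n h n.lt_succ_self),
      mul_add, mul_one]
    have := ih fun i hm hn => hx i hm (hn.trans n.lt_succ_self)
    omega

variable (hB : B.IsProperlyOrdered)

theorem index_vershik_of_pos (hq : B.IsToeplitz q) {n : ℕ} {x : B.PathSpace}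
    (hx : 0 < x.index q 0 n) : (vershik hB x).index q 0 n + 1 = x.index q 0 n ∧
      (vershik hB x).tower n = x.tower n := by
  have hx' : ¬ ∀ i, 0 ≤ i → i < n → IsMax (x.1 i) := fun h =>
    hx.ne' ((index_eq_zero_iff hq).2 h)
  push Not at hx'
  obtain ⟨j, -, hjn, hj⟩ := hx'
  obtain ⟨k, h1, h2, h3, h4, h5⟩ := vershik_of_not_isMaxPath hB (fun h => hj (h j))
  have hkn : k < n := by
    by_contra! hk
    exact hj (h1 j (by omega))
  refine ⟨?_, tower_eq_of_edge_eq (h5 n hkn)⟩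
  rw [index_add q (Nat.zero_le _) hkn, index_add q (Nat.zero_le _) hkn x,
    index_congr q (fun i hi _ => h5 i hi), index_succ q (Nat.zero_le _),
    index_succ q (Nat.zero_le _), (index_eq_zero_iff hq).2 (fun i _ hi => h1 i hi),
    edgeRank_of_covBy hq h3]
  have := index_of_isMin hq (Nat.zero_le k) (fun i _ hi => h4 i hi)
  rw [mul_add, mul_one]
  omega

theorem index_vershik_of_eq_zero (hq : B.IsToeplitz q) {n : ℕ} {x : B.PathSpace}
    (hx : x.index q 0 n = 0) : (vershik hB x).index q 0 n + 1 = qProd q 0 n := by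
  refine index_of_isMin hq (Nat.zero_le n) fun i _ hi => ?_
  by_cases hmax : x.IsMaxPath
  · exact vershik_of_isMaxPath hB hmax i
  · obtain ⟨k, h1, h2, h3, h4, h5⟩ := vershik_of_not_isMaxPath hB hmax
    refine h4 i (hi.trans_le ?_)
    by_contra! hk
    exact h2 ((index_eq_zero_iff hq).1 hx k (Nat.zero_le _) hk)

theorem index_iterate_vershik (hq : B.IsToeplitz q) {n k : ℕ} {x : B.PathSpace}
    (hx : k ≤ x.index q 0 n) : ((vershik hB)^[k] x).index q 0 n + k = x.index q 0 n ∧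
      ((vershik hB)^[k] x).tower n = x.tower n := by
  induction k with
  | zero => simp
  | succ k ih =>
    obtain ⟨h1, h2⟩ := ih (by omega)
    rw [Function.iterate_succ_apply']
    obtain ⟨h3, h4⟩ := index_vershik_of_pos hB hq (n := n) (x := (vershik hB)^[k] x) (by omega)
    exact ⟨by omega, h4.trans h2⟩

/-- One step leads to the top position p_n - 1, possibly of another tower, and p_n - 1 descents lead
back to 0. -/
theorem index_iterate_vershik_qProd (hq : B.IsToeplitz q) {n : ℕ} {x : B.PathSpace}
    (hx : x.index q 0 n = 0) : ((vershik hB)^[qProd q 0 n] x).index q 0 n = 0 := by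
  have h1 := index_vershik_of_eq_zero hB hq hx
  obtain ⟨h2, -⟩ := index_iterate_vershik hB hq (n := n) (x := vershik hB x) le_rfl
  rw [← h1, Function.iterate_succ_apply]
  omega

end PathSpace

/-! ### Sets determined by an initial segment -/

theorem tower_eq_of_initial {n : ℕ} {x y : B.PathSpace} (h : ∀ i < n, x.1 i = y.1 i) :
    x.tower n = y.tower n := by
  cases n with
  | zero =>
    have : Subsingleton (B.V 0) := (Nat.card_eq_one_iff_unique.1 B.card_V_zero).1
    exact Subsingleton.elim _ _
  | succ n => exact PathSpace.tower_succ_eq (h n n.lt_succ_self)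

/-- Whether a path belongs to `A` is determined by its first `n` edges. -/
def DeterminedAt (n : ℕ) (A : Set B.PathSpace) : Prop :=
  ∀ ⦃x y : B.PathSpace⦄, (∀ i < n, x.1 i = y.1 i) → (x ∈ A ↔ y ∈ A)

theorem DeterminedAt.mono {m n : ℕ} (h : m ≤ n) {A : Set B.PathSpace} (hA : DeterminedAt m A) :
    DeterminedAt n A := fun _ _ hxy => hA fun i hi => hxy i (hi.trans_le h)

theorem DeterminedAt.compl {n : ℕ} {A : Set B.PathSpace} (hA : DeterminedAt n A) :
    DeterminedAt n Aᶜ := fun _ _ hxy => not_congr (hA hxy)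

theorem DeterminedAt.inter {n : ℕ} {A A' : Set B.PathSpace} (hA : DeterminedAt n A)
    (hA' : DeterminedAt n A') : DeterminedAt n (A ∩ A') :=
  fun _ _ hxy => and_congr (hA hxy) (hA' hxy)

theorem DeterminedAt.union {n : ℕ} {A A' : Set B.PathSpace} (hA : DeterminedAt n A)
    (hA' : DeterminedAt n A') : DeterminedAt n (A ∪ A') :=
  fun _ _ hxy => or_congr (hA hxy) (hA' hxy)

theorem isOpen_edge_eq (i : ℕ) (e : B.E i) : IsOpen {x : B.PathSpace | x.1 i = e} := by
  let _ : ∀ n, TopologicalSpace (B.E n) := fun _ => ⊥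
  have : ∀ n, DiscreteTopology (B.E n) := fun _ => ⟨rfl⟩
  exact ⟨(fun a : ∀ n, B.E n => a i) ⁻¹' {e}, (isOpen_discrete _).preimage (continuous_apply i), rfl⟩

theorem DeterminedAt.isOpen {n : ℕ} {A : Set B.PathSpace} (hA : DeterminedAt n A) : IsOpen A := by
  have : A = ⋃ x ∈ A, ⋂ i ∈ Set.Iio n, {y : B.PathSpace | y.1 i = x.1 i} := by
    ext y
    simp only [Set.mem_iUnion, Set.mem_iInter, Set.mem_ofPred_eq, Set.mem_Iio, exists_prop]
    exact ⟨fun hy => ⟨y, hy, fun _ _ => rfl⟩, fun ⟨x, hx, h⟩ => (hA h).2 hx⟩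
  rw [this]
  exact isOpen_biUnion fun x _ => (Set.finite_Iio n).isOpen_biInter fun i _ => isOpen_edge_eq i _

theorem DeterminedAt.measurableSet {n : ℕ} {A : Set B.PathSpace} (hA : DeterminedAt n A) :
    MeasurableSet A := hA.isOpen.measurableSet

theorem exists_initial_subset {u : Set B.PathSpace} (hu : IsOpen u) {x : B.PathSpace}
    (hx : x ∈ u) : ∃ n, ∀ y : B.PathSpace, (∀ i < n, x.1 i = y.1 i) → y ∈ u := by
  let _ : ∀ n, TopologicalSpace (B.E n) := fun _ => ⊥
  obtain ⟨v, hv, rfl⟩ := hu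
  obtain ⟨I, w, hw, hwv⟩ := isOpen_pi_iff.1 hv x.1 hx
  refine ⟨I.sup id + 1, fun y hy => hwv fun i hi => ?_⟩
  rw [← hy i (Nat.lt_succ_of_le (Finset.le_sup (f := id) hi))]
  exact (hw i hi).2

theorem isPiSystem_determinedAt :
    IsPiSystem {A : Set B.PathSpace | ∃ n, DeterminedAt n A} := by
  rintro A ⟨m, hA⟩ A' ⟨n, hA'⟩ -
  exact ⟨max m n, (hA.mono (le_max_left _ _)).inter (hA'.mono (le_max_right _ _))⟩

theorem borel_eq_generateFrom_determinedAt : (inferInstance : MeasurableSpace B.PathSpace) =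
    MeasurableSpace.generateFrom {A : Set B.PathSpace | ∃ n, DeterminedAt n A} := by
  apply le_antisymm
  · refine MeasurableSpace.generateFrom_le fun u hu => ?_
    -- The n-th set is the largest subset of `u` determined by the first `n` edges, so the union is
    -- countable.
    have : u = ⋃ n, {x : B.PathSpace | ∀ y : B.PathSpace, (∀ i < n, x.1 i = y.1 i) → y ∈ u} := by
      ext x
      simp only [Set.mem_iUnion, Set.mem_ofPred_eq]
      exact ⟨exists_initial_subset hu, fun ⟨n, hn⟩ => hn x fun _ _ => rfl⟩
    rw [this]
    refine MeasurableSet.iUnion fun n => MeasurableSpace.measurableSet_generateFrom ⟨n, ?_⟩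
    intro x y hxy
    exact ⟨fun h z hz => h z fun i hi => (hxy i hi).trans (hz i hi),
      fun h z hz => h z fun i hi => (hxy i hi).symm.trans (hz i hi)⟩
  · refine MeasurableSpace.generateFrom_le ?_
    rintro A ⟨n, hA⟩
    exact hA.measurableSet

/-- The paths on tower `t` of level `n` that have position `j`. -/
def floor (q : ℕ → ℕ) {n : ℕ} (t : B.V n) (j : ℕ) : Set B.PathSpace :=
  {x | x.tower n = t ∧ x.index q 0 n = j}

theorem determinedAt_tower {n : ℕ} (P : B.V n → Prop) :
    DeterminedAt n {x : B.PathSpace | P (x.tower n)} := fun x y h => by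
  rw [Set.mem_ofPred_eq, Set.mem_ofPred_eq, tower_eq_of_initial h]

theorem determinedAt_index (q : ℕ → ℕ) {m n : ℕ} (P : ℕ → Prop) :
    DeterminedAt n {x : B.PathSpace | P (x.index q m n)} := fun x y h => by
  rw [Set.mem_ofPred_eq, Set.mem_ofPred_eq, PathSpace.index_congr q fun i _ hi => h i hi]

theorem determinedAt_floor (q : ℕ → ℕ) {n : ℕ} (t : B.V n) (j : ℕ) :
    DeterminedAt n (floor q t j) :=
  (determinedAt_tower (· = t)).inter (determinedAt_index q (· = j))

theorem initial_eq_of_mem_floor (hq : B.IsToeplitz q) {n j : ℕ} {t : B.V n} {x y : B.PathSpace}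
    (hx : x ∈ floor q t j) (hy : y ∈ floor q t j) : ∀ i < n, x.1 i = y.1 i :=
  fun _ hi => PathSpace.edge_eq_of_index_eq hq (Nat.zero_le n) (hx.1.trans hy.1.symm)
    (hx.2.trans hy.2.symm) (Nat.zero_le _) hi

end OrderedBratteliDiagram

namespace OrderedBratteliDiagram

variable {B : OrderedBratteliDiagram} {q : ℕ → ℕ}

/-! ### Invariant measures -/

theorem sum_measureReal_inter_fiber {α β : Type*} [MeasurableSpace α] (ν : Measure α)
    [IsFiniteMeasure ν] {A : Set α} (hA : MeasurableSet A) (g : α → β) (s : Finset β)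
    (hs : ∀ x ∈ A, g x ∈ s) (hg : ∀ b ∈ s, MeasurableSet {x | g x = b}) :
    ∑ b ∈ s, ν.real (A ∩ {x | g x = b}) = ν.real A := by
  classical
  rw [← measureReal_biUnion_finset (μ := ν)]
  · congr 1
    ext x
    simp only [Set.mem_iUnion, Set.mem_inter_iff, Set.mem_ofPred_eq, exists_prop]
    exact ⟨fun ⟨_, _, h, _⟩ => h, fun h => ⟨g x, hs x h, h, rfl⟩⟩
  · intro b _ b' _ hbb
    refine Set.disjoint_left.2 fun x hx hx' => hbb (hx.2.symm.trans hx'.2)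
  · exact fun b hb => hA.inter (hg b hb)

theorem measurableSet_tower_eq {n : ℕ} (t : B.V n) :
    MeasurableSet {x : B.PathSpace | x.tower n = t} :=
  (determinedAt_tower (· = t)).measurableSet

theorem measurableSet_index_eq (q : ℕ → ℕ) (m n j : ℕ) :
    MeasurableSet {x : B.PathSpace | x.index q m n = j} :=
  (determinedAt_index q (· = j)).measurableSet

theorem sum_measureReal_tower (ν : Measure B.PathSpace) [IsFiniteMeasure ν] (n : ℕ)
    {A : Set B.PathSpace} (hA : MeasurableSet A) :
    ∑ t : B.V n, ν.real (A ∩ {x | x.tower n = t}) = ν.real A :=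
  sum_measureReal_inter_fiber ν hA _ _ (fun _ _ => Finset.mem_univ _)
    fun t _ => measurableSet_tower_eq t

theorem sum_measureReal_floor (hq : B.IsToeplitz q) (ν : Measure B.PathSpace) [IsFiniteMeasure ν]
    {n : ℕ} (t : B.V n) {A : Set B.PathSpace} (hA : MeasurableSet A) :
    ∑ j ∈ Finset.range (qProd q 0 n), ν.real (A ∩ floor q t j)
      = ν.real (A ∩ {x | x.tower n = t}) := by
  rw [← sum_measureReal_inter_fiber ν (hA.inter (measurableSet_tower_eq t))
    (PathSpace.index q 0 n) (Finset.range (qProd q 0 n))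
    (fun x _ => Finset.mem_range.2 (PathSpace.index_lt hq (Nat.zero_le n) x))
    fun j _ => measurableSet_index_eq q 0 n j]
  refine Finset.sum_congr rfl fun j _ => ?_
  rw [Set.inter_assoc]
  rfl

theorem preimage_floor (hB : B.IsProperlyOrdered) (hq : B.IsToeplitz q) {n j : ℕ} (t : B.V n)
    (hj : j + 1 < qProd q 0 n) : vershik hB ⁻¹' floor q t j = floor q t (j + 1) := by
  ext x
  simp only [floor, Set.mem_preimage, Set.mem_ofPred_eq]
  rcases Nat.eq_zero_or_pos (x.index q 0 n) with h | h
  · have := PathSpace.index_vershik_of_eq_zero hB hq h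
    omega
  · obtain ⟨h1, h2⟩ := PathSpace.index_vershik_of_pos hB hq h
    rw [h2]
    refine and_congr Iff.rfl ⟨?_, ?_⟩ <;> omega

variable {hB : B.IsProperlyOrdered} {ν : Measure B.PathSpace}

theorem measureReal_floor_eq_zero_floor (hq : B.IsToeplitz q)
    (hν : MeasurePreserving (vershik hB) ν ν) {n j : ℕ} (t : B.V n) (hj : j < qProd q 0 n) :
    ν.real (floor q t j) = ν.real (floor q t 0) := by
  induction j with
  | zero => rfl
  | succ j ih =>
    rw [← ih (by omega), ← preimage_floor hB hq t hj,
      hν.measureReal_preimage (determinedAt_floor q t j).measurableSet.nullMeasurableSet]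

theorem measureReal_floor [IsFiniteMeasure ν] (hq : B.IsToeplitz q)
    (hν : MeasurePreserving (vershik hB) ν ν) {n j : ℕ} (t : B.V n) (hj : j < qProd q 0 n) :
    ν.real (floor q t j) = ν.real {x | x.tower n = t} / qProd q 0 n := by
  have h := sum_measureReal_floor hq ν t MeasurableSet.univ
  simp only [Set.univ_inter] at h
  rw [Finset.sum_congr rfl fun i hi =>
    measureReal_floor_eq_zero_floor hq hν t (Finset.mem_range.1 hi), Finset.sum_const,
    Finset.card_range, nsmul_eq_mul] at h
  have hp : (qProd q 0 n : ℝ) ≠ 0 := by exact_mod_cast (hq.qProd_pos 0 n).ne'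
  rw [measureReal_floor_eq_zero_floor hq hν t hj, ← h, mul_div_cancel_left₀ _ hp]

/-- The set consists of p_m floors of tower `t`, one for each position below level `m`, and each
carries the fraction 1/p_n of the tower. -/
theorem measureReal_index_eq [IsFiniteMeasure ν] (hq : B.IsToeplitz q)
    (hν : MeasurePreserving (vershik hB) ν ν) {m n s : ℕ} (h : m ≤ n) (t : B.V n)
    (hs : s < qProd q m n) :
    ν.real {x | x.tower n = t ∧ x.index q m n = s}
      = ν.real {x | x.tower n = t} / qProd q m n := by
  have hA : MeasurableSet {x : B.PathSpace | x.tower n = t ∧ x.index q m n = s} :=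
    (measurableSet_tower_eq t).inter (measurableSet_index_eq q m n s)
  rw [← sum_measureReal_inter_fiber ν hA (PathSpace.index q 0 m) (Finset.range (qProd q 0 m))
    (fun x _ => Finset.mem_range.2 (PathSpace.index_lt hq (Nat.zero_le m) x))
    fun j _ => measurableSet_index_eq q 0 m j]
  have hfl : ∀ i ∈ Finset.range (qProd q 0 m),
      ν.real ({x | x.tower n = t ∧ x.index q m n = s} ∩ {x | x.index q 0 m = i})
        = ν.real {x | x.tower n = t} / qProd q 0 n := by
    intro i hi
    have hi' := Finset.mem_range.1 hi
    have hlt : i + qProd q 0 m * s < qProd q 0 n := by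
      rw [← qProd_mul q (Nat.zero_le m) h]
      calc i + qProd q 0 m * s < qProd q 0 m + qProd q 0 m * s := by omega
        _ = qProd q 0 m * (s + 1) := by ring
        _ ≤ _ := Nat.mul_le_mul_left _ hs
    rw [← measureReal_floor hq hν t hlt]
    congr 1
    ext x
    simp only [floor, Set.mem_inter_iff, Set.mem_ofPred_eq, and_assoc]
    refine and_congr Iff.rfl ?_
    rw [PathSpace.index_add q (Nat.zero_le m) h]
    have h1 := PathSpace.index_lt hq (Nat.zero_le m) x
    constructor
    · rintro ⟨h2, h3⟩
      rw [h2, h3]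
    · intro h2
      have h3 := congrArg (· / qProd q 0 m) h2
      simp only [Nat.add_mul_div_left _ _ (hq.qProd_pos 0 m), Nat.div_eq_of_lt h1,
        Nat.div_eq_of_lt hi', zero_add] at h3
      rw [h3] at h2
      exact ⟨h3, by omega⟩
  rw [Finset.sum_congr rfl hfl, Finset.sum_const, Finset.card_range, nsmul_eq_mul,
    ← qProd_mul q (Nat.zero_le m) h, Nat.cast_mul]
  have hp : (qProd q 0 m : ℝ) ≠ 0 := by exact_mod_cast (hq.qProd_pos 0 m).ne'
  have hp' : (qProd q m n : ℝ) ≠ 0 := by exact_mod_cast (hq.qProd_pos m n).ne'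
  field_simp

theorem measureReal_index_mem [IsFiniteMeasure ν] (hq : B.IsToeplitz q)
    (hν : MeasurePreserving (vershik hB) ν ν) {m n : ℕ} (h : m ≤ n) (t : B.V n)
    {s : Finset ℕ} (hs : s ⊆ Finset.range (qProd q m n)) :
    ν.real {x | x.tower n = t ∧ x.index q m n ∈ s}
      = s.card * (ν.real {x | x.tower n = t} / qProd q m n) := by
  have hA : MeasurableSet {x : B.PathSpace | x.tower n = t ∧ x.index q m n ∈ s} :=
    (measurableSet_tower_eq t).inter (determinedAt_index q (· ∈ s)).measurableSet
  rw [← sum_measureReal_inter_fiber ν hA (PathSpace.index q m n) s (fun x hx => hx.2)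
    fun j _ => measurableSet_index_eq q m n j, ← nsmul_eq_mul, ← Finset.sum_const]
  refine Finset.sum_congr rfl fun j hj => ?_
  rw [← measureReal_index_eq hq hν h t (Finset.mem_range.1 (hs hj))]
  congr 1
  ext x
  simp only [Set.mem_inter_iff, Set.mem_ofPred_eq, and_assoc]
  exact and_congr Iff.rfl ⟨fun h => h.2, fun h => ⟨h ▸ hj, h⟩⟩

theorem measureReal_tower_inter [IsFiniteMeasure ν] (hq : B.IsToeplitz q)
    (hν : MeasurePreserving (vershik hB) ν ν) {m n : ℕ} (h : m ≤ n) (t₁ : B.V m) (t₂ : B.V n) :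
    ν.real ({x | x.tower m = t₁} ∩ {x | x.tower n = t₂})
      = (positions q t₁ t₂).card * (ν.real {x | x.tower n = t₂} / qProd q m n) := by
  rw [← measureReal_index_mem hq hν h t₂ (positions_subset q t₁ t₂)]
  congr 1
  ext x
  simp only [Set.mem_inter_iff, Set.mem_ofPred_eq, mem_positions]
  constructor
  · rintro ⟨rfl, rfl⟩
    exact ⟨rfl, PathSpace.index_lt hq h x, vertexAt_tower hq h x⟩
  · rintro ⟨rfl, -, h2⟩
    exact ⟨by rw [← h2, vertexAt_tower hq h], rfl⟩

theorem measureReal_tower_eq_sum [IsFiniteMeasure ν] (hq : B.IsToeplitz q)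
    (hν : MeasurePreserving (vershik hB) ν ν) {m n : ℕ} (h : m ≤ n) (t₁ : B.V m) :
    ν.real {x | x.tower m = t₁}
      = ∑ t₂ : B.V n, (positions q t₁ t₂).card * (ν.real {x | x.tower n = t₂} / qProd q m n) := by
  rw [← sum_measureReal_tower ν n (measurableSet_tower_eq t₁)]
  exact Finset.sum_congr rfl fun t₂ _ => measureReal_tower_inter hq hν h t₁ t₂

theorem sum_measureReal_tower_univ (ν : Measure B.PathSpace) [IsProbabilityMeasure ν] (n : ℕ) :
    ∑ t : B.V n, ν.real {x | x.tower n = t} = 1 := by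
  simpa using sum_measureReal_tower ν n MeasurableSet.univ

/-- Sets determined at level n are unions of floors, whose masses depend only on those of the
towers; these sets form a generating π-system. -/
theorem eq_of_measureReal_tower_eq {ν' : Measure B.PathSpace} [IsProbabilityMeasure ν]
    [IsProbabilityMeasure ν'] (hq : B.IsToeplitz q) (hν : MeasurePreserving (vershik hB) ν ν)
    (hν' : MeasurePreserving (vershik hB) ν' ν')
    (h : ∀ n (t : B.V n), ν.real {x | x.tower n = t} = ν'.real {x | x.tower n = t}) : ν = ν' := by
  refine ext_of_generate_finite _ borel_eq_generateFrom_determinedAt isPiSystem_determinedAt ?_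
    (by simp)
  rintro A ⟨n, hA⟩
  rw [← measureReal_eq_measureReal_iff, ← sum_measureReal_tower ν n hA.measurableSet,
    ← sum_measureReal_tower ν' n hA.measurableSet]
  refine Finset.sum_congr rfl fun t _ => ?_
  rw [← sum_measureReal_floor hq ν t hA.measurableSet,
    ← sum_measureReal_floor hq ν' t hA.measurableSet]
  refine Finset.sum_congr rfl fun j hj => ?_
  have hfl : A ∩ floor q t j = ∅ ∨ A ∩ floor q t j = floor q t j := by
    rcases (A ∩ floor q t j).eq_empty_or_nonempty with h0 | ⟨x, hxA, hx⟩
    · exact Or.inl h0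
    · exact Or.inr (Set.inter_eq_right.2 fun y hy =>
        (hA (initial_eq_of_mem_floor hq hx hy)).1 hxA)
  rcases hfl with h0 | h0
  · simp [h0]
  · rw [h0, measureReal_floor hq hν t (Finset.mem_range.1 hj),
      measureReal_floor hq hν' t (Finset.mem_range.1 hj), h]

/-- Tower masses of level `m` are combinations of those of level `n` with the same weights, at most
1, for both measures. Closeness at high levels therefore passes down. -/
theorem abs_measureReal_tower_sub_le {ν' : Measure B.PathSpace} [IsFiniteMeasure ν]
    [IsFiniteMeasure ν'] (hq : B.IsToeplitz q) (hν : MeasurePreserving (vershik hB) ν ν)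
    (hν' : MeasurePreserving (vershik hB) ν' ν') {m n : ℕ} (h : m ≤ n) (t₁ : B.V m) :
    |ν.real {x | x.tower m = t₁} - ν'.real {x | x.tower m = t₁}|
      ≤ ∑ t₂ : B.V n, |ν.real {x | x.tower n = t₂} - ν'.real {x | x.tower n = t₂}| := by
  rw [measureReal_tower_eq_sum hq hν h t₁, measureReal_tower_eq_sum hq hν' h t₁,
    ← Finset.sum_sub_distrib]
  refine (Finset.abs_sum_le_sum_abs _ _).trans (Finset.sum_le_sum fun t₂ _ => ?_)
  have hp : (0 : ℝ) < qProd q m n := by exact_mod_cast hq.qProd_pos m n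
  rw [← mul_sub, ← sub_div, abs_mul, abs_div, Nat.abs_cast, Nat.abs_cast, mul_div_assoc']
  refine div_le_of_le_mul₀ hp.le (abs_nonneg _) ?_
  rw [mul_comm]
  gcongr
  exact_mod_cast card_positions_le q t₁ t₂

end OrderedBratteliDiagram

namespace OrderedBratteliDiagram

variable {B : OrderedBratteliDiagram} {q : ℕ → ℕ} {hB : B.IsProperlyOrdered}
  {ν : Measure B.PathSpace} {d : ℕ} {lam : ℂ}

/-! ### Equidistribution of the towers -/

variable (B) in
/-- The normalized norms of the suffix sums converge to `1 / d`, uniformly in the vertices. -/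
def SuffixSumsConverge (q : ℕ → ℕ) (lam : ℂ) (d : ℕ) : Prop :=
  ∀ ε > (0 : ℝ), ∃ N : ℕ, ∀ (m n : ℕ) (_ : N ≤ m) (hmn : m < n) (t₁ : B.V m) (t₂ : B.V n),
    |‖suffixSum q lam hmn.le t₁ t₂‖ / (qProd q m n : ℝ) - 1 / (d : ℝ)| < ε

theorem IsProper.card_V (hp : B.IsProper d) {n : ℕ} (hn : 2 ≤ n) : Fintype.card (B.V n) = d := by
  rw [← Nat.card_eq_fintype_card, hp.h3 n hn]

theorem norm_suffixSum_le (hq : B.IsToeplitz q) (hlam : ‖lam‖ = 1) {m n : ℕ} (h : m ≤ n)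
    (t₁ : B.V m) (t₂ : B.V n) : ‖suffixSum q lam h t₁ t₂‖ ≤ (positions q t₁ t₂).card := by
  rw [suffixSum_eq hq]
  refine (norm_sum_le _ _).trans_eq ?_
  simp [hlam]

/-- The proportion of paths to `t₂` that start in `t` bounds the normalized suffix sum from above,
and the mass of `t` is the average of these proportions over `t₂`. -/
theorem exists_lt_measureReal_tower [IsProbabilityMeasure ν] (hq : B.IsToeplitz q)
    (hν : MeasurePreserving (vershik hB) ν ν) (hlam : ‖lam‖ = 1)
    (hU : SuffixSumsConverge B q lam d) {ε : ℝ} (hε : 0 < ε) :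
    ∃ N, ∀ m ≥ N, ∀ t : B.V m, 1 / (d : ℝ) - ε ≤ ν.real {x | x.tower m = t} := by
  obtain ⟨N, hN⟩ := hU ε hε
  refine ⟨N, fun m hm t => ?_⟩
  rw [measureReal_tower_eq_sum hq hν m.le_succ t]
  have h1 := sum_measureReal_tower_univ ν (m + 1)
  calc 1 / (d : ℝ) - ε
      = ∑ t₂ : B.V (m + 1), (1 / (d : ℝ) - ε) * ν.real {x | x.tower (m + 1) = t₂} := by
        rw [← Finset.mul_sum, h1, mul_one]
    _ ≤ _ := by
        refine Finset.sum_le_sum fun t₂ _ => ?_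
        rw [mul_div_assoc', mul_comm _ (ν.real _), mul_comm _ (ν.real _), mul_div_assoc]
        refine mul_le_mul_of_nonneg_left ?_ measureReal_nonneg
        have h2 := (abs_lt.1 (hN m (m + 1) hm m.lt_succ_self t t₂)).1
        have h3 := norm_suffixSum_le hq hlam m.le_succ t t₂
        have h4 : ‖suffixSum q lam m.le_succ t t₂‖ / (qProd q m (m + 1) : ℝ)
          ≤ (positions q t t₂).card / (qProd q m (m + 1) : ℝ) := by gcongr
        linarith

theorem exists_abs_measureReal_tower_sub_le [IsProbabilityMeasure ν] (hq : B.IsToeplitz q)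
    (hp : B.IsProper d) (hν : MeasurePreserving (vershik hB) ν ν) (hlam : ‖lam‖ = 1)
    (hU : SuffixSumsConverge B q lam d) {ε : ℝ} (hε : 0 < ε) :
    ∃ N, ∀ m ≥ N, ∀ t : B.V m, |ν.real {x | x.tower m = t} - 1 / (d : ℝ)| ≤ ε := by
  classical
  rcases Nat.eq_zero_or_pos d with rfl | hd
  · have := hp.card_V le_rfl
    exact absurd (nonempty_V (B := B) 2) (not_nonempty_iff.2 (Fintype.card_eq_zero_iff.1 this))
  have hd' : (1 : ℝ) ≤ d := by exact_mod_cast hd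
  -- The upper bound comes from subtracting the d - 1 other lower bounds from 1, which costs (d -
  -- 1)ε/d ≤ ε.
  obtain ⟨N, hN⟩ := exists_lt_measureReal_tower hq hν hlam hU (div_pos hε (by linarith : (0:ℝ) < d))
  refine ⟨max N 2, fun m hm t => abs_le.2 ⟨?_, ?_⟩⟩
  · have h1 := hN m (le_of_max_le_left hm) t
    have h2 : ε / d ≤ ε := div_le_self hε.le hd'
    linarith
  · have h1 := sum_measureReal_tower_univ ν m
    rw [← Finset.add_sum_erase _ _ (Finset.mem_univ t)] at h1
    have h2 := Finset.card_nsmul_le_sum (Finset.univ.erase t)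
      (fun t => ν.real {x | x.tower m = t}) _ fun t' _ => hN m (le_of_max_le_left hm) t'
    rw [Finset.card_erase_of_mem (Finset.mem_univ t), Finset.card_univ,
      hp.card_V (le_of_max_le_right hm), nsmul_eq_mul, Nat.cast_sub hd, Nat.cast_one] at h2
    have h3 : ((d : ℝ) - 1) * (1 / d - ε / d) = 1 - 1 / d - ε + ε / d := by
      field_simp
      ring
    have h4 : 0 ≤ ε / d := by positivity
    linarith

theorem tendsto_measureReal_tower [IsProbabilityMeasure ν] (hq : B.IsToeplitz q)
    (hp : B.IsProper d) (hν : MeasurePreserving (vershik hB) ν ν) (hlam : ‖lam‖ = 1)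
    (hU : SuffixSumsConverge B q lam d) (t : (n : ℕ) → B.V n) :
    Tendsto (fun n => ν.real {x | x.tower n = t n}) atTop (𝓝 (1 / (d : ℝ))) := by
  rw [Metric.tendsto_atTop']
  intro ε hε
  obtain ⟨N, hN⟩ := exists_abs_measureReal_tower_sub_le hq hp hν hlam hU (half_pos hε)
  refine ⟨N, fun n hn => ?_⟩
  rw [Real.dist_eq]
  exact (hN n hn.le (t n)).trans_lt (half_lt_self hε)

theorem invariant_unique [IsProbabilityMeasure ν] {ν' : Measure B.PathSpace}
    [IsProbabilityMeasure ν'] (hq : B.IsToeplitz q) (hp : B.IsProper d)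
    (hν : MeasurePreserving (vershik hB) ν ν) (hν' : MeasurePreserving (vershik hB) ν' ν')
    (hlam : ‖lam‖ = 1) (hU : SuffixSumsConverge B q lam d) : ν = ν' := by
  refine eq_of_measureReal_tower_eq hq hν hν' fun m t => ?_
  refine eq_of_abs_sub_le_all fun ε hε => ?_
  rcases Nat.eq_zero_or_pos d with rfl | hd
  · have := hp.card_V le_rfl
    exact absurd (nonempty_V (B := B) 2) (not_nonempty_iff.2 (Fintype.card_eq_zero_iff.1 this))
  have hd' : (0 : ℝ) < d := by exact_mod_cast hd
  have hε' : 0 < ε / (2 * d) := by positivity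
  obtain ⟨N, hN⟩ := exists_abs_measureReal_tower_sub_le hq hp hν hlam hU hε'
  obtain ⟨N', hN'⟩ := exists_abs_measureReal_tower_sub_le hq hp hν' hlam hU hε'
  obtain ⟨n, hn⟩ : ∃ n, n ≥ N ∧ n ≥ N' ∧ n ≥ m ∧ n ≥ 2 :=
    ⟨N + N' + m + 2, by omega, by omega, by omega, by omega⟩
  refine (abs_measureReal_tower_sub_le hq hν hν' hn.2.2.1 t).trans ?_
  refine (Finset.sum_le_card_nsmul _ _ (2 * (ε / (2 * d))) fun t₂ _ => ?_).trans_eq ?_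
  · have h1 := abs_le.1 (hN n hn.1 t₂)
    have h2 := abs_le.1 (hN' n hn.2.1 t₂)
    exact abs_le.2 ⟨by linarith, by linarith⟩
  · rw [Finset.card_univ, hp.card_V hn.2.2.2, nsmul_eq_mul]
    field_simp

/-! ### Arithmetic of the eigenvalue -/

/-- As a and b are coprime, λ has order b, so λ^{p_n} has order b / gcd(b, p_n). -/
theorem exists_isPrimitiveRoot_pow_qProd (hq : B.IsToeplitz q) (hd : d ≠ 0) {a b : ℤ} (hab : IsCoprime a b)
    (hb : ∀ᶠ n : ℕ in atTop, b / (Int.gcd b (qProd q 0 n : ℤ) : ℤ) = (d : ℤ))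
    (hlam : lam = Complex.exp (2 * Complex.I * Real.pi * (a / b))) :
    ∃ k : ℕ, k ≠ 0 ∧ lam ^ k = 1 ∧ ∀ᶠ n in atTop, IsPrimitiveRoot (lam ^ qProd q 0 n) d := by
  have hbpos : 0 < b := by
    obtain ⟨n, hn⟩ := hb.exists
    have hg : 0 < Int.gcd b (qProd q 0 n : ℤ) :=
      Int.gcd_pos_of_ne_zero_right _ (by exact_mod_cast (hq.qProd_pos 0 n).ne')
    rw [← Int.ediv_mul_cancel (Int.gcd_dvd_left b (qProd q 0 n : ℤ)), hn]
    positivity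
  lift b to ℕ using hbpos.le
  have hb0 : b ≠ 0 := by omega
  have hprim : IsPrimitiveRoot lam b := by
    have h := (Complex.isPrimitiveRoot_exp b hb0).zpow_of_gcd_eq_one a
      (Int.isCoprime_iff_gcd_eq_one.1 hab)
    rw [← Complex.exp_int_mul] at h
    rw [hlam]
    refine (congrArg Complex.exp ?_).symm ▸ h
    push_cast
    ring
  refine ⟨b, hb0, hprim.pow_eq_one, hb.mono fun n hn => ?_⟩
  have h1 : orderOf (lam ^ qProd q 0 n) = d := by
    rw [orderOf_pow' _ (hq.qProd_pos 0 n).ne', ← hprim.eq_orderOf]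
    have : ((b / b.gcd (qProd q 0 n) : ℕ) : ℤ) = d := by
      rw [← hn]
      simp
    exact_mod_cast this
  rw [← h1]
  exact IsPrimitiveRoot.orderOf _

/-! ### Continuous eigenvalues -/

theorem exists_pos_le_norm_sub_one (d : ℕ) (hd : d ≠ 0) :
    ∃ κ > (0 : ℝ), ∀ z : ℂ, z ^ d = 1 → z ≠ 1 → κ ≤ ‖z - 1‖ := by
  have hfin : {z : ℂ | z ^ d = 1 ∧ z ≠ 1}.Finite := by
    refine (Polynomial.nthRoots d (1 : ℂ)).toFinset.finite_toSet.subset fun z hz => ?_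
    simpa [Polynomial.mem_nthRoots (Nat.pos_of_ne_zero hd)] using hz.1
  have hnhds : {z : ℂ | z ^ d = 1 ∧ z ≠ 1}ᶜ ∈ 𝓝 (1 : ℂ) :=
    hfin.isClosed.isOpen_compl.mem_nhds fun h => h.2 rfl
  obtain ⟨κ, hκ, hsub⟩ := Metric.mem_nhds_iff.1 hnhds
  refine ⟨κ, hκ, fun z hz hz1 => ?_⟩
  by_contra! h
  exact hsub (by rwa [Metric.mem_ball, dist_eq_norm]) ⟨hz, hz1⟩

/-- All edges are maximal up to index `n`, and maximal edges have a common source, which fixes the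
end-point of the preceding edge. The last edge is lost, since its end-point is not fixed. -/
theorem initial_eq_of_index_eq_zero (hq : B.IsToeplitz q) (hp : B.IsProper d)
    {x y : B.PathSpace} {n : ℕ} (hx : x.index q 0 (n + 1) = 0) (hy : y.index q 0 (n + 1) = 0) :
    ∀ i < n, x.1 i = y.1 i := by
  rw [PathSpace.index_eq_zero_iff hq] at hx hy
  intro i hi
  have hsrc := hp.h4 (i + 1) (by omega) _ _ (hx (i + 1) (by omega) (by omega))
    (hy (i + 1) (by omega) (by omega))
  have htgt : B.tgt (x.1 i) = B.tgt (y.1 i) := by rw [x.2 i, y.2 i, hsrc]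
  refine edgeRank_inj htgt ?_
  rw [edgeRank_eq_zero_iff.2 (hx i (by omega) (by omega)),
    edgeRank_eq_zero_iff.2 (hy i (by omega) (by omega))]

theorem not_isContinuousEigenvalue (hd : 2 ≤ d) (hq : B.IsToeplitz q) (hp : B.IsProper d)
    (hlam : ‖lam‖ = 1) (hprim : ∀ᶠ n in atTop, IsPrimitiveRoot (lam ^ qProd q 0 n) d) :
    ¬ IsContinuousEigenvalue (vershik hB) lam := by
  rintro ⟨f, hf, hf0, hfT⟩
  obtain ⟨x₀, hx₀, -⟩ := hB.1
  have hx₀' : ∀ n, x₀.index q 0 n = 0 := fun n =>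
    (PathSpace.index_eq_zero_iff hq).2 fun i _ _ => hx₀ i
  have hiter : ∀ k x, f ((vershik hB)^[k] x) = lam ^ k * f x := by
    intro k x
    induction k with
    | zero => simp
    | succ k ih => rw [Function.iterate_succ_apply', hfT, ih, pow_succ]; ring
  have hclose : ∀ ε > 0, ∃ N, ∀ n ≥ N, ∀ x : B.PathSpace, x.index q 0 n = 0 →
      ‖f x - f x₀‖ < ε := by
    intro ε hε
    obtain ⟨N, hN⟩ := exists_initial_subset (x := x₀)
      ((Metric.isOpen_ball (x := f x₀) (ε := ε)).preimage hf) (Metric.mem_ball_self hε)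
    refine ⟨N + 1, fun n hn x hx => ?_⟩
    obtain ⟨k, rfl⟩ : ∃ k, n = k + 1 := ⟨n - 1, by omega⟩
    have := hN x fun i hi => initial_eq_of_index_eq_zero hq hp (hx₀' (k + 1)) hx i (by omega)
    rwa [Set.mem_preimage, Metric.mem_ball, dist_eq_norm] at this
  have hfx₀ : f x₀ = 0 := by
    obtain ⟨κ, hκ, hgap⟩ := exists_pos_le_norm_sub_one d (by omega)
    by_contra hne
    obtain ⟨N, hN⟩ := hclose (κ * ‖f x₀‖) (by positivity)
    obtain ⟨n, hn, hnN⟩ := (hprim.and (eventually_ge_atTop N)).exists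
    have h1 := hN n hnN _ (PathSpace.index_iterate_vershik_qProd hB hq (hx₀' n))
    rw [hiter, ← sub_one_mul, norm_mul] at h1
    have h2 := hgap _ hn.pow_eq_one (hn.ne_one (by omega))
    exact absurd h1 (not_lt.2 (mul_le_mul_of_nonneg_right h2 (norm_nonneg _)))
  -- The modulus of `f` is constant along orbits, and the orbit of `x` reaches position 0 at every
  -- level, where `f` is close to `f x₀ = 0`.
  refine hf0 (funext fun x => ?_)
  rw [Pi.zero_apply, ← norm_eq_zero]
  refine le_antisymm (le_of_forall_pos_le_add fun ε hε => ?_) (norm_nonneg _)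
  obtain ⟨N, hN⟩ := hclose ε hε
  obtain ⟨h1, -⟩ := PathSpace.index_iterate_vershik hB hq (n := N) (x := x) le_rfl
  have h2 := hN N le_rfl _ (Nat.add_eq_right.1 h1)
  rw [hiter, hfx₀, sub_zero, norm_mul, norm_pow, hlam, one_pow, one_mul] at h2
  linarith

end OrderedBratteliDiagram

/-! ### Weak limits of approximate eigenvectors -/

-- By Banach–Alaoglu the sequence has a weak limit along an ultrafilter. Pairing with `h` keeps the
-- limit nonzero, and moving `U` to its adjoint passes the eigenvalue equation to the limit.
open InnerProductSpace in
theorem exists_eigenvector_of_weak_limit {H : Type*} [NormedAddCommGroup H]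
    [InnerProductSpace ℂ H] [CompleteSpace H] (U : H →L[ℂ] H) (lam : ℂ) (g : ℕ → H)
    (hg : ∀ n, ‖g n‖ ≤ 1) (hU : Tendsto (fun n => ‖U (g n) - lam • g n‖) atTop (𝓝 0))
    {h : H} {δ : ℝ} (hδ : 0 < δ) (hgh : ∀ᶠ n in atTop, δ ≤ ‖inner ℂ (g n) h‖) :
    ∃ v : H, v ≠ 0 ∧ U v = lam • v := by
  let F : Ultrafilter ℕ := hyperfilter ℕ
  have hF : (F : Filter ℕ) ≤ atTop := Nat.hyperfilter_le_atTop
  let φ : ℕ → WeakDual ℂ H := fun n => StrongDual.toWeakDual (toDual ℂ H (g n))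
  have hK := WeakDual.isCompact_closedBall (𝕜 := ℂ) (E := H) 0 1
  obtain ⟨ψ, -, hψ⟩ := hK.ultrafilter_le_nhds (F.map φ) (by
    rw [le_principal_iff]
    refine mem_map.2 (univ_mem' fun n => ?_)
    simpa [φ] using hg n)
  have hψ' : Tendsto φ F (𝓝 ψ) := hψ
  set v : H := (toDual ℂ H).symm (WeakDual.toStrongDual ψ) with hv
  have hlim : ∀ y, Tendsto (fun n => inner ℂ (g n) y) F (𝓝 (inner ℂ v y)) := by
    intro y
    have h1 := (tendsto_iff_forall_eval_tendsto_topDualPairing.1 hψ') y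
    have h2 : inner ℂ v y = ψ y := by
      rw [hv, toDual_symm_apply]
      rfl
    rw [h2]
    exact h1
  refine ⟨v, ?_, ?_⟩
  · rintro h0
    have h1 := (hlim h).norm
    rw [h0, inner_zero_left, norm_zero] at h1
    exact absurd (ge_of_tendsto h1 (hF hgh)) (not_le.2 hδ)
  · refine sub_eq_zero.1 (ext_inner_right ℂ fun y => ?_)
    rw [inner_zero_left]
    have h1 : ∀ w, inner ℂ (U w - lam • w) y
        = inner ℂ w (ContinuousLinearMap.adjoint U y - (starRingEnd ℂ lam) • y) := by
      intro w
      rw [inner_sub_left, inner_sub_right, ContinuousLinearMap.adjoint_inner_right,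
        inner_smul_left, inner_smul_right]
    have h2 : Tendsto (fun n => inner ℂ (U (g n) - lam • g n) y) F (𝓝 (inner ℂ (U v - lam • v) y)) := by
      simp only [h1]
      exact hlim _
    refine tendsto_nhds_unique h2 ?_
    refine squeeze_zero_norm (fun n => norm_inner_le_norm _ _) ?_
    simpa using (hU.mono_left hF).mul_const ‖y‖

/-! ### From suffix sums to an eigenfunction. -/

namespace OrderedBratteliDiagram

variable {B : OrderedBratteliDiagram} {q : ℕ → ℕ} {hB : B.IsProperlyOrdered}
  {ν : Measure B.PathSpace} {d : ℕ} {lam : ℂ}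

theorem IsProper.le_of_isToeplitz (hp : B.IsProper d) (hq : B.IsToeplitz q) {n : ℕ} (hn : 2 ≤ n) :
    d ≤ q (n + 1) := by
  obtain ⟨t⟩ := nonempty_V (B := B) (n + 1)
  choose e he het using fun v => hp.h2 n (by omega) v t
  rw [← hp.h3 n hn, ← hq n t]
  exact Nat.card_le_card_of_injective (fun v => (⟨e v, het v⟩ : {e // B.tgt e = t}))
    fun v w h => by
      rw [← he v, ← he w]
      exact congrArg (fun z => B.src z.1) h

/-- The factors are at least 2 only from `q 3` on; the summand 2 absorbs the first levels. -/
theorem le_qProd_add_two (hd : 2 ≤ d) (hp : B.IsProper d) (hq : B.IsToeplitz q) (n : ℕ) :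
    n ≤ qProd q 0 n + 2 := by
  induction n with
  | zero => omega
  | succ n ih =>
    rcases le_or_gt 2 n with hn | hn
    · rw [qProd_succ q (Nat.zero_le n)]
      have h1 := hd.trans (hp.le_of_isToeplitz hq hn)
      have h2 := hq.qProd_pos 0 n
      nlinarith
    · omega

theorem tendsto_qProd_atTop (hd : 2 ≤ d) (hp : B.IsProper d) (hq : B.IsToeplitz q) :
    Tendsto (fun n => (qProd q 0 n : ℝ)) atTop atTop := by
  refine tendsto_natCast_atTop_atTop.comp ?_
  exact tendsto_atTop_mono (fun n => Nat.sub_le_of_le_add (le_qProd_add_two hd hp hq n))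
    (tendsto_sub_atTop_nat 2)

theorem measurable_of_determinedAt {β : Type*} [MeasurableSpace β] {n : ℕ} {f : B.PathSpace → β}
    (hf : ∀ x y : B.PathSpace, (∀ i < n, x.1 i = y.1 i) → f x = f y) : Measurable f :=
  fun s _ => DeterminedAt.measurableSet (n := n) fun x y h => by
    rw [Set.mem_preimage, Set.mem_preimage, hf x y h]

theorem measureReal_index_eq_zero [IsProbabilityMeasure ν] (hq : B.IsToeplitz q)
    (hν : MeasurePreserving (vershik hB) ν ν) (n : ℕ) :
    ν.real {x | x.index q 0 n = 0} = 1 / qProd q 0 n := by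
  rw [← sum_measureReal_tower ν n (measurableSet_index_eq q 0 n 0),
    ← sum_measureReal_tower_univ ν n, Finset.sum_div]
  refine Finset.sum_congr rfl fun t _ => ?_
  rw [← measureReal_floor hq hν t (hq.qProd_pos 0 n), Set.inter_comm]
  rfl

open Classical in
/-- The function supported by tower `t` of level `n` that takes the value `lam⁻¹ ^ j` at
position `j`. -/
noncomputable def towerFun (q : ℕ → ℕ) (lam : ℂ) {n : ℕ} (t : B.V n) (x : B.PathSpace) : ℂ :=
  if x.tower n = t then lam⁻¹ ^ x.index q 0 n else 0

theorem norm_towerFun_le (hlam : ‖lam‖ = 1) {n : ℕ} (t : B.V n) (x : B.PathSpace) :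
    ‖towerFun q lam t x‖ ≤ 1 := by
  rw [towerFun]
  split_ifs <;> simp [hlam]

theorem measurable_towerFun {n : ℕ} (t : B.V n) : Measurable (towerFun q lam t) :=
  measurable_of_determinedAt (n := n) fun x y h => by
    rw [towerFun, towerFun, tower_eq_of_initial h, PathSpace.index_congr q fun i _ hi => h i hi]

theorem memLp_towerFun [IsFiniteMeasure ν] (hlam : ‖lam‖ = 1) {n : ℕ} (t : B.V n) :
    MemLp (towerFun q lam t) 2 ν :=
  MemLp.of_bound (measurable_towerFun t).aestronglyMeasurable 1
    (Eventually.of_forall (norm_towerFun_le hlam t))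

theorem towerFun_vershik (hq : B.IsToeplitz q) (hlam : ‖lam‖ = 1) {n : ℕ} (t : B.V n)
    {x : B.PathSpace} (hx : x.index q 0 n ≠ 0) :
    towerFun q lam t (vershik hB x) = lam * towerFun q lam t x := by
  obtain ⟨h1, h2⟩ := PathSpace.index_vershik_of_pos hB hq (Nat.pos_of_ne_zero hx)
  have h0 : lam ≠ 0 := fun h => by simp [h] at hlam
  rw [towerFun, towerFun, h2, ← h1]
  split_ifs
  · rw [pow_succ']
    field_simp
  · simp

/-- At position s between the two levels the parts below level `m` cancel, so the integrand is
λ^{p_m s}; each such s has the same mass in tower `t₂`. -/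
theorem integral_conj_towerFun_mul [IsFiniteMeasure ν] (hq : B.IsToeplitz q)
    (hν : MeasurePreserving (vershik hB) ν ν) (hlam : ‖lam‖ = 1) {m n : ℕ} (h : m ≤ n)
    (t₁ : B.V m) (t₂ : B.V n) :
    ∫ x, towerFun q lam t₁ x * starRingEnd ℂ (towerFun q lam t₂ x) ∂ν
      = starRingEnd ℂ (suffixSum q lam h t₁ t₂)
        * (ν.real {x | x.tower n = t₂} / qProd q m n : ℝ) := by
  have h0 : lam ≠ 0 := fun h => by simp [h] at hlam
  have hconj : starRingEnd ℂ lam = lam⁻¹ := (Complex.inv_eq_conj hlam).symm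
  have hpt : ∀ x : B.PathSpace, towerFun q lam t₁ x * starRingEnd ℂ (towerFun q lam t₂ x)
      = ∑ s ∈ positions q t₁ t₂, {x : B.PathSpace | x.tower n = t₂ ∧ x.index q m n = s}.indicator
          (fun _ => starRingEnd ℂ ((lam ^ qProd q 0 m)⁻¹ ^ s)) x := by
    classical
    intro x
    by_cases h2 : x.tower n = t₂
    · have h3 : ∀ s, {x : B.PathSpace | x.tower n = t₂ ∧ x.index q m n = s}.indicator
          (fun _ => starRingEnd ℂ ((lam ^ qProd q 0 m)⁻¹ ^ s)) x
          = if x.index q m n = s then starRingEnd ℂ ((lam ^ qProd q 0 m)⁻¹ ^ s) else 0 := by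
        intro s
        simp [Set.indicator_apply, h2]
      simp only [h3, Finset.sum_ite_eq]
      have h4 : x.index q m n ∈ positions q t₁ t₂ ↔ x.tower m = t₁ := by
        rw [mem_positions, ← h2, vertexAt_tower hq h]
        exact and_iff_right (PathSpace.index_lt hq h x)
      simp only [h4, towerFun, h2, if_true]
      split_ifs with h5
      · rw [PathSpace.index_add q (Nat.zero_le m) h]
        simp only [map_pow, map_inv₀, hconj, inv_inv]
        rw [pow_add, pow_mul, inv_pow, ← mul_assoc, inv_mul_cancel₀ (pow_ne_zero _ h0), one_mul]
        simp only [inv_pow, inv_inv]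
      · simp
    · rw [towerFun, towerFun, if_neg h2, map_zero, mul_zero]
      refine (Finset.sum_eq_zero fun s _ => ?_).symm
      exact Set.indicator_of_notMem (fun h => h2 h.1) _
  have hms : ∀ s, MeasurableSet {x : B.PathSpace | x.tower n = t₂ ∧ x.index q m n = s} :=
    fun s => (measurableSet_tower_eq t₂).inter (measurableSet_index_eq q m n s)
  simp only [hpt]
  rw [integral_finsetSum _ fun s _ => (integrable_const _).indicator (hms s), suffixSum_eq hq,
    map_sum, Finset.sum_mul]
  refine Finset.sum_congr rfl fun s hs => ?_
  rw [integral_indicator_const _ (hms s), measureReal_index_eq hq hν h t₂ (mem_positions.1 hs).1,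
    mul_comm, Complex.real_smul]

theorem isMeasurableEigenvalue_of_suffixSumsConverge [IsProbabilityMeasure ν] (hd : 2 ≤ d)
    (hq : B.IsToeplitz q) (hp : B.IsProper d) (hν : MeasurePreserving (vershik hB) ν ν)
    (hlam : ‖lam‖ = 1) (hU : SuffixSumsConverge B q lam d) :
    IsMeasurableEigenvalue (vershik hB) ν lam := by
  have hd' : (0 : ℝ) < d := by positivity
  have ho : ∀ n, 2 ≤ n → ∃ t : B.V n, 1 / (d : ℝ) ≤ ν.real {x | x.tower n = t} := by
    intro n hn
    have h1 := sum_measureReal_tower_univ ν n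
    by_contra! hcon
    have h2 := Finset.sum_lt_sum_of_nonempty (Finset.univ_nonempty (α := B.V n))
      fun t _ => hcon t
    rw [h1, Finset.sum_const, Finset.card_univ, hp.card_V hn, nsmul_eq_mul,
      mul_one_div_cancel hd'.ne'] at h2
    exact lt_irrefl _ h2
  have ho' : ∀ n, ∃ t : B.V n, 2 ≤ n → 1 / (d : ℝ) ≤ ν.real {x | x.tower n = t} := by
    intro n
    -- Below level 2 the number of vertices need not be d, and any vertex will do.
    by_cases hn : 2 ≤ n
    · exact (ho n hn).imp fun _ h _ => h
    · exact ⟨(nonempty_V n).some, fun h => absurd h hn⟩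
  choose o ho using ho'
  let g : ∀ n, Lp ℂ 2 ν := fun n => (memLp_towerFun (q := q) (ν := ν) hlam (o n)).toLp _
  obtain ⟨N, hN⟩ := hU (1 / (2 * d)) (by positivity)
  obtain ⟨m, hm⟩ : ∃ m, m = max N 2 := ⟨_, rfl⟩
  obtain ⟨t⟩ := nonempty_V (B := B) m
  refine (exists_eigenvector_of_weak_limit
    (Lp.compMeasurePreservingₗᵢ ℂ (vershik hB) hν : Lp ℂ 2 ν →ₗᵢ[ℂ] Lp ℂ 2 ν).toContinuousLinearMap
    lam g ?_ ?_ (h := (memLp_towerFun (q := q) (ν := ν) hlam t).toLp _)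
    (δ := 1 / (2 * d) * (1 / d)) (by positivity) ?_).elim fun v ⟨hv0, hv⟩ => ?_
  · intro n
    have h1 := Lp.norm_le_of_ae_bound (f := g n) zero_le_one (by
      filter_upwards [MemLp.coeFn_toLp (memLp_towerFun (q := q) (ν := ν) hlam (o n))] with x hx
      rw [hx]
      exact norm_towerFun_le hlam _ x)
    have h2 : measureUnivNNReal ν = 1 := by simp [measureUnivNNReal]
    simpa [h2] using h1
  · have hs : ∀ n, MeasurableSet {x : B.PathSpace | x.index q 0 n = 0} :=
      fun n => measurableSet_index_eq q 0 n 0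
    -- The eigenvalue equation fails only at position 0, by at most 2, on a set of measure 1/p_n.
    refine squeeze_zero (fun _ => norm_nonneg _) (g := fun n =>
      ‖(2 : ℂ)‖ * (1 / (qProd q 0 n : ℝ)) ^ (1 / (2 : ENNReal).toReal)) (fun n => ?_) ?_
    · rw [← measureReal_index_eq_zero hq hν n,
        ← norm_indicatorConstLp (hs := hs n) (hμs := measure_ne_top _ _) two_ne_zero
          ENNReal.ofNat_ne_top]
      refine Lp.norm_le_norm_of_ae_le ?_
      have h1 := Lp.coeFn_compMeasurePreserving (g n) hν
      have h2 := Lp.coeFn_smul lam (g n)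
      have h3 := MemLp.coeFn_toLp (memLp_towerFun (q := q) (ν := ν) hlam (o n))
      have h4 := hν.quasiMeasurePreserving.ae h3
      have h5 := Lp.coeFn_sub (Lp.compMeasurePreserving (vershik hB) hν (g n)) (lam • g n)
      filter_upwards [h1, h2, h3, h4, h5,
        indicatorConstLp_coeFn (p := 2) (hs := hs n) (hμs := measure_ne_top ν _) (c := (2 : ℂ))]
        with x h1 h2 h3 h4 h5 h6
      change ‖(Lp.compMeasurePreserving (vershik hB) hν (g n) - lam • g n : Lp ℂ 2 ν) x‖ ≤ _
      rw [h5, Pi.sub_apply, h1, h2, h6, Pi.smul_apply, Function.comp_apply, h4, h3, smul_eq_mul]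
      by_cases hx : x.index q 0 n = 0
      · rw [Set.indicator_of_mem (show x ∈ {x : B.PathSpace | x.index q 0 n = 0} from hx)]
        refine (norm_sub_le _ _).trans ?_
        rw [norm_mul, hlam, one_mul]
        have := norm_towerFun_le (q := q) hlam (o n) x
        have := norm_towerFun_le (q := q) hlam (o n) (vershik hB x)
        norm_num
        linarith
      · rw [towerFun_vershik hq hlam _ hx, sub_self, norm_zero]
        exact norm_nonneg _
    · have h1 : Tendsto (fun n => 1 / (qProd q 0 n : ℝ)) atTop (𝓝 0) := by
        simp only [one_div]
        exact (tendsto_qProd_atTop hd hp hq).inv_tendsto_atTop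
      have h2 := (h1.rpow_const (p := 1 / (2 : ENNReal).toReal) (Or.inr (by simp))).const_mul ‖(2 : ℂ)‖
      rwa [Real.zero_rpow (by simp), mul_zero] at h2
  · filter_upwards [eventually_gt_atTop m] with n hn
    rw [L2.inner_def]
    have h1 : ∫ x, inner ℂ (g n x) ((memLp_towerFun (q := q) (ν := ν) hlam t).toLp _ x) ∂ν
        = ∫ x, towerFun q lam t x * starRingEnd ℂ (towerFun q lam (o n) x) ∂ν := by
      refine integral_congr_ae ?_
      filter_upwards [MemLp.coeFn_toLp (memLp_towerFun (q := q) (ν := ν) hlam t),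
        MemLp.coeFn_toLp (memLp_towerFun (q := q) (ν := ν) hlam (o n))] with x hx hx'
      rw [hx, hx']
      rfl
    rw [h1, integral_conj_towerFun_mul hq hν hlam hn.le, norm_mul, RCLike.norm_conj,
      Complex.norm_real, Real.norm_of_nonneg (by positivity)]
    have h2 := (abs_lt.1 (hN m n (by omega) hn t (o n))).1
    have h3 := ho n (by omega)
    have h4 : 1 / (d : ℝ) = 1 / (2 * d) + 1 / (2 * d) := by field_simp; norm_num
    have h5 : 1 / (2 * (d : ℝ)) ≤ ‖suffixSum q lam hn.le t (o n)‖ / qProd q m n := by linarith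
    exact (mul_le_mul h5 h3 (by positivity) (by positivity)).trans_eq (by ring)
  · refine ⟨v, Lp.memLp v, fun h => hv0 ((Lp.eq_zero_iff_ae_eq_zero).2 h), ?_⟩
    have h1 := Lp.coeFn_compMeasurePreserving v hν
    have h2 := Lp.coeFn_smul lam v
    have h3 : Lp.compMeasurePreserving (vershik hB) hν v = lam • v := hv
    rw [h3] at h1
    filter_upwards [h1, h2] with x hx1 hx2
    rw [← Function.comp_apply (f := v), ← hx1, hx2]
    rfl

end OrderedBratteliDiagram

/-! ### Eigenfunctions with finitely many values -/

/-- If g is an eigenfunction then g^k is invariant, because λ^k = 1. Dividing g by a k-th root of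
g^k keeps the eigenvalue and leaves a k-th root of unity wherever g ≠ 0; elsewhere 0/0 = 0. -/
theorem IsMeasurableEigenvalue.exists_root_valued {X : Type*} [MeasurableSpace X] {T : X → X}
    {μ : Measure X} [IsFiniteMeasure μ] (hT : MeasurePreserving T μ μ) {lam : ℂ} {k : ℕ}
    (hk : k ≠ 0) (hlam : lam ^ k = 1) (h : IsMeasurableEigenvalue T μ lam) :
    ∃ f : X → ℂ, Measurable f ∧ (∀ x, f x = 0 ∨ f x ^ k = 1) ∧ 0 < μ.real {x | f x ≠ 0} ∧
      ∀ᵐ x ∂μ, f (T x) = lam * f x := by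
  obtain ⟨g, hg, hg0, hgT⟩ := h
  set g' := hg.1.mk g with hg'
  have hgm : Measurable g' := hg.1.stronglyMeasurable_mk.measurable
  have hgg' : g =ᵐ[μ] g' := hg.1.ae_eq_mk
  have hroot : ∀ z : ℂ, (z ^ (1 / (k : ℂ))) ^ k = z := fun z => by
    rw [one_div]
    exact Complex.cpow_nat_inv_pow z hk
  refine ⟨fun x => g' x / (g' x ^ k) ^ (1 / (k : ℂ)), ?_, fun x => ?_, ?_, ?_⟩
  · exact hgm.div ((hgm.pow_const k).pow_const _)
  · rcases eq_or_ne (g' x) 0 with h0 | h0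
    · exact Or.inl (by simp [h0])
    · refine Or.inr ?_
      change (g' x / (g' x ^ k) ^ (1 / (k : ℂ))) ^ k = 1
      rw [div_pow, hroot, div_self (pow_ne_zero _ h0)]
  · rw [measureReal_def, ENNReal.toReal_pos_iff]
    refine ⟨pos_iff_ne_zero.2 fun h0 => hg0 ?_, measure_lt_top _ _⟩
    have h1 : ∀ᵐ x ∂μ, g' x / (g' x ^ k) ^ (1 / (k : ℂ)) = 0 := by
      rw [ae_iff]
      exact h0
    filter_upwards [h1, hgg'] with x hx hx'
    rw [hx', Pi.zero_apply]
    rcases div_eq_zero_iff.1 hx with h2 | h2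
    · exact h2
    · have h3 := hroot (g' x ^ k)
      rw [h2, zero_pow hk] at h3
      exact pow_eq_zero_iff hk |>.1 h3.symm
  · filter_upwards [hgT, hgg', hT.quasiMeasurePreserving.ae hgg'] with x h1 h2 h3
    have h4 : g' (T x) = lam * g' x := by rw [← h3, h1, h2]
    rw [h4, mul_pow, hlam, one_mul, mul_div_assoc]

/-! ### Functions on residue classes -/

theorem IsPrimitiveRoot.pow_eq_pow_iff_modEq_of_pos {ω : ℂ} {d : ℕ} (hω : IsPrimitiveRoot ω d)
    (hd : 0 < d) {r s : ℕ} : ω ^ r = ω ^ s ↔ r ≡ s [MOD d] := by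
  have h : ∀ j, ω ^ j = ω ^ (j % d) := fun j => by
    conv_lhs => rw [← Nat.mod_add_div j d, pow_add, pow_mul, hω.pow_eq_one, one_pow, mul_one]
  refine ⟨fun hrs => ?_, fun hrs => by rw [h r, h s, hrs]⟩
  rw [h r, h s] at hrs
  exact hω.pow_inj (Nat.mod_lt _ hd) (Nat.mod_lt _ hd) hrs

open Classical in
/-- The indices `s < Q` for which `c * ω ^ s` is not the value of `c'` at `θ s`. -/
noncomputable def mismatches {W : Type*} (Q : ℕ) (θ : ℕ → W) (ω c : ℂ) (c' : W → ℂ) : Finset ℕ :=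
  (Finset.range Q).filter fun s => c * ω ^ s ≠ c' (θ s)

theorem mem_mismatches {W : Type*} {Q s : ℕ} {θ : ℕ → W} {ω c : ℂ} {c' : W → ℂ} :
    s ∈ mismatches Q θ ω c c' ↔ s < Q ∧ c * ω ^ s ≠ c' (θ s) := by
  simp [mismatches]

section Residues

variable {W : Type*} [Fintype W] {d Q : ℕ} {ω c : ℂ} {θ : ℕ → W} {c' : W → ℂ}

theorem card_residues (hd : 0 < d) (r : ℕ) :
    Q / d ≤ ((Finset.range Q).filter fun s => s ≡ r [MOD d]).card ∧
      ((Finset.range Q).filter fun s => s ≡ r [MOD d]).card ≤ Q / d + 1 := by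
  rw [← Nat.count_eq_card_filter_range, Nat.count_modEq_card Q hd r]
  split_ifs <;> omega

/-- Each residue class mod d has more elements than there are mismatches, so each of the d distinct
values c ω^r is taken by `c'`; with only d points in `W`, each is taken once. -/
theorem exists_bijective_of_mismatches (hd : 0 < d) (hW : Fintype.card W = d)
    (hω : IsPrimitiveRoot ω d) (hc : c ≠ 0) (hQ : d ≤ Q)
    (hbad : 2 * d * (mismatches Q θ ω c c').card < Q) :
    ∃ τ : Fin d → W, Function.Bijective τ ∧ ∀ r, c' (τ r) = c * ω ^ r.1 := by
  have h1 : ∀ r : Fin d, ∃ t, c' t = c * ω ^ r.1 := by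
    intro r
    have h2 : (mismatches Q θ ω c c').card
        < ((Finset.range Q).filter fun s => s ≡ r [MOD d]).card := by
      have h3 := (card_residues (Q := Q) hd r).1
      refine lt_of_lt_of_le ?_ h3
      have h4 : Q < 2 * d * (Q / d) := by
        have h5 : Q < d * (Q / d + 1) := Nat.lt_mul_div_succ Q hd
        have h6 : 1 ≤ Q / d := Nat.div_pos hQ hd
        have h7 : d * 1 ≤ d * (Q / d) := Nat.mul_le_mul_left d h6
        rw [mul_add] at h5
        rw [mul_assoc]
        omega
      exact lt_of_mul_lt_mul_left (hbad.trans h4) (Nat.zero_le _)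
    obtain ⟨s, hs, hs'⟩ := Finset.exists_mem_notMem_of_card_lt_card h2
    rw [Finset.mem_filter, Finset.mem_range] at hs
    rw [mem_mismatches, not_and_not_right] at hs'
    refine ⟨θ s, ?_⟩
    rw [← hs' hs.1, (hω.pow_eq_pow_iff_modEq_of_pos hd).2 hs.2]
  choose τ hτ using h1
  refine ⟨τ, (Fintype.bijective_iff_injective_and_card τ).2 ⟨fun r r' h => ?_, ?_⟩, hτ⟩
  · have h2 : ω ^ r.1 = ω ^ r'.1 := mul_left_cancel₀ hc (by rw [← hτ, ← hτ, h])
    exact Fin.ext (hω.pow_inj r.2 r'.2 h2)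
  · rw [Fintype.card_fin, hW]

theorem injective_of_mismatches (hd : 0 < d) (hW : Fintype.card W = d)
    (hω : IsPrimitiveRoot ω d) (hc : c ≠ 0) (hQ : d ≤ Q)
    (hbad : 2 * d * (mismatches Q θ ω c c').card < Q) :
    Function.Injective c' ∧ ∀ t, c' t ≠ 0 := by
  obtain ⟨τ, hτ, h⟩ := exists_bijective_of_mismatches hd hW hω hc hQ hbad
  refine ⟨fun t t' htt => ?_, fun t => ?_⟩
  · obtain ⟨r, rfl⟩ := hτ.2 t
    obtain ⟨r', rfl⟩ := hτ.2 t'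
    rw [h, h] at htt
    rw [Fin.ext (hω.pow_inj r.2 r'.2 (mul_left_cancel₀ hc htt))]
  · obtain ⟨r, rfl⟩ := hτ.2 t
    rw [h]
    exact mul_ne_zero hc (pow_ne_zero _ (hω.ne_zero hd.ne'))

/-- By injectivity of `c'`, a matching `s` lies over `t` exactly when c ω^s = c' t, which singles
out one residue class. -/
theorem exists_residue_of_mismatches (hd : 0 < d) (hW : Fintype.card W = d)
    (hω : IsPrimitiveRoot ω d) (hc : c ≠ 0) (hQ : d ≤ Q)
    (hbad : 2 * d * (mismatches Q θ ω c c').card < Q) {A : Finset ℕ} {t : W}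
    (hA : ∀ s, s ∈ A ↔ s < Q ∧ θ s = t) :
    ∃ r, A \ (Finset.range Q).filter (fun s => s ≡ r [MOD d]) ∪
      (Finset.range Q).filter (fun s => s ≡ r [MOD d]) \ A ⊆ mismatches Q θ ω c c' := by
  obtain ⟨τ, hτ, h⟩ := exists_bijective_of_mismatches hd hW hω hc hQ hbad
  obtain ⟨hinj, -⟩ := injective_of_mismatches hd hW hω hc hQ hbad
  obtain ⟨r, rfl⟩ := hτ.2 t
  refine ⟨r, fun s hs => ?_⟩
  by_contra hgood
  rw [mem_mismatches, not_and_not_right] at hgood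
  simp only [Finset.mem_union, Finset.mem_sdiff, hA, Finset.mem_filter, Finset.mem_range] at hs
  rcases hs with ⟨⟨h1, h2⟩, h3⟩ | ⟨⟨h1, h2⟩, h3⟩
  · have h4 := hgood h1
    rw [h2, h] at h4
    exact h3 ⟨h1, (hω.pow_eq_pow_iff_modEq_of_pos hd).1 (mul_left_cancel₀ hc h4)⟩
  · refine h3 ⟨h1, hinj ?_⟩
    rw [h, ← hgood h1, (hω.pow_eq_pow_iff_modEq_of_pos hd).2 h2]

theorem le_card_of_mismatches (hd : 0 < d) (hW : Fintype.card W = d)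
    (hω : IsPrimitiveRoot ω d) (hc : c ≠ 0) (hQ : d ≤ Q)
    (hbad : 2 * d * (mismatches Q θ ω c c').card < Q) {A : Finset ℕ} {t : W}
    (hA : ∀ s, s ∈ A ↔ s < Q ∧ θ s = t) :
    Q ≤ 2 * d * (A.card + (mismatches Q θ ω c c').card) := by
  obtain ⟨r, hr⟩ := exists_residue_of_mismatches hd hW hω hc hQ hbad hA
  have h1 := (card_residues (Q := Q) hd r).1
  have h2 : ((Finset.range Q).filter fun s => s ≡ r [MOD d]).card
      ≤ A.card + (mismatches Q θ ω c c').card := by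
    refine (Finset.card_le_card_sdiff_add_card (t := A)).trans ?_
    rw [add_comm]
    gcongr
    exact Finset.subset_union_right.trans hr
  have h5 : Q < d * (Q / d + 1) := Nat.lt_mul_div_succ Q hd
  have h6 : 1 ≤ Q / d := Nat.div_pos hQ hd
  calc Q ≤ d * (Q / d + 1) := h5.le
    _ ≤ d * (2 * (A.card + (mismatches Q θ ω c c').card)) := by gcongr; omega
    _ = _ := by ring

/-- On a residue class all terms are equal, so the norm of that sum is the size of the class, within
1 of Q/d. Each mismatch changes the sum by at most 1. -/
theorem abs_norm_sum_sub_le_of_mismatches (hd : 0 < d) (hW : Fintype.card W = d)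
    (hω : IsPrimitiveRoot ω d) (hc : c ≠ 0) (hQ : d ≤ Q)
    (hbad : 2 * d * (mismatches Q θ ω c c').card < Q) {A : Finset ℕ} {t : W}
    (hA : ∀ s, s ∈ A ↔ s < Q ∧ θ s = t) :
    |‖∑ s ∈ A, ω ^ s‖ - (Q : ℝ) / d| ≤ (mismatches Q θ ω c c').card + 1 := by
  obtain ⟨r, hr⟩ := exists_residue_of_mismatches hd hW hω hc hQ hbad hA
  set R := (Finset.range Q).filter fun s => s ≡ r [MOD d] with hR
  have hnorm : ∀ s, ‖ω ^ s‖ = 1 := fun s => by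
    rw [norm_pow, hω.norm'_eq_one hd.ne', one_pow]
  have h1 : ‖∑ s ∈ A, ω ^ s - ∑ s ∈ R, ω ^ s‖ ≤ (mismatches Q θ ω c c').card := by
    rw [← Finset.sum_sdiff_sub_sum_sdiff]
    refine (norm_sub_le _ _).trans ?_
    have h2 : ∀ S : Finset ℕ, ‖∑ s ∈ S, ω ^ s‖ ≤ S.card := fun S =>
      (norm_sum_le _ _).trans_eq (by simp [hnorm])
    refine (add_le_add (h2 _) (h2 _)).trans ?_
    rw [← Nat.cast_add, ← Finset.card_union_of_disjoint disjoint_sdiff_sdiff]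
    exact_mod_cast Finset.card_le_card hr
  have h2 : ‖∑ s ∈ R, ω ^ s‖ = R.card := by
    rw [Finset.sum_congr rfl fun s hs =>
      (hω.pow_eq_pow_iff_modEq_of_pos hd).2 (Finset.mem_filter.1 hs).2, Finset.sum_const, nsmul_eq_mul,
      norm_mul, hnorm, mul_one, Complex.norm_natCast]
  have h3 := abs_le.1 ((abs_norm_sub_norm_le _ _).trans h1)
  rw [h2] at h3
  obtain ⟨h4, h5⟩ := card_residues (Q := Q) hd r
  have h6 : (R.card : ℝ) ≤ (Q : ℝ) / d + 1 := by
    have : (R.card : ℝ) ≤ ((Q / d : ℕ) : ℝ) + 1 := by exact_mod_cast h5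
    exact this.trans (by gcongr; exact Nat.cast_div_le)
  have h7 : (Q : ℝ) / d ≤ R.card + 1 := by
    rw [div_le_iff₀ (by exact_mod_cast hd)]
    have h8 : Q ≤ (R.card + 1) * d := by
      rw [mul_comm]
      exact (Nat.lt_mul_div_succ Q hd).le.trans (by gcongr)
    exact_mod_cast h8
  exact abs_le.2 ⟨by linarith, by linarith⟩

end Residues

namespace OrderedBratteliDiagram

variable {B : OrderedBratteliDiagram} {q : ℕ → ℕ} {hB : B.IsProperlyOrdered}
  {ν : Measure B.PathSpace} {d : ℕ} {lam : ℂ}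

/-! ### Approximation by functions of an initial segment -/

theorem isSetRing_determinedAt : IsSetRing {A : Set B.PathSpace | ∃ n, DeterminedAt n A} where
  empty_mem := ⟨0, fun _ _ _ => Iff.rfl⟩
  union_mem := by
    rintro A A' ⟨m, hA⟩ ⟨n, hA'⟩
    exact ⟨max m n, (hA.mono (le_max_left _ _)).union (hA'.mono (le_max_right _ _))⟩
  sdiff_mem := by
    rintro A A' ⟨m, hA⟩ ⟨n, hA'⟩
    exact ⟨max m n, (hA.mono (le_max_left _ _)).inter (hA'.compl.mono (le_max_right _ _))⟩

theorem exists_determinedAt_measureReal_symmDiff_lt [IsFiniteMeasure ν] {A : Set B.PathSpace}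
    (hA : MeasurableSet A) {ε : ℝ} (hε : 0 < ε) :
    ∃ n C, DeterminedAt n C ∧ ν.real (symmDiff C A) < ε := by
  obtain ⟨C, ⟨n, hC⟩, hlt⟩ := exists_measure_symmDiff_lt_of_generateFrom_isSetRing (μ := ν)
    isSetRing_determinedAt
    ⟨{Set.univ}, Set.countable_singleton _,
      Set.singleton_subset_iff.2 ⟨0, fun _ _ _ => Iff.rfl⟩, by simp⟩
    borel_eq_generateFrom_determinedAt hA (ENNReal.ofReal_pos.2 hε)
  refine ⟨n, C, hC, ?_⟩
  rwa [measureReal_def, ← ENNReal.lt_ofReal_iff_toReal_lt (measure_ne_top _ _)]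

/-- Each level set of `f` is replaced by a nearby set determined by finitely many edges. `h x` is
the value whose set contains `x`; it is right unless `x` lies in one of the symmetric differences.
-/
theorem exists_determined_function [IsFiniteMeasure ν] {f : B.PathSpace → ℂ} (hf : Measurable f)
    (R : Finset ℂ) (hR : ∀ x, f x ∈ R) {ε : ℝ} (hε : 0 < ε) :
    ∃ (N : ℕ) (h : B.PathSpace → ℂ), (∀ x y : B.PathSpace, (∀ i < N, x.1 i = y.1 i) → h x = h y) ∧
      ν.real {x | f x ≠ h x} < ε := by
  classical
  have hpos : 0 < ε / (R.card + 1) := by positivity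
  choose n C hC hlt using fun z : ℂ => exists_determinedAt_measureReal_symmDiff_lt (ν := ν)
    (hf (measurableSet_singleton z)) hpos
  let g : (ℂ → Prop) → ℂ := fun p => if hp : ∃ z, p z then hp.choose else 0
  have hg : ∀ p z, (∀ w, p w ↔ w = z) → g p = z := fun p z hp => by
    have h1 : ∃ w, p w := ⟨z, (hp z).2 rfl⟩
    simp only [g, dif_pos h1]
    exact (hp _).1 h1.choose_spec
  refine ⟨R.sup n, fun x => g fun z => z ∈ R ∧ x ∈ C z, fun x y hxy => ?_, ?_⟩
  · refine congrArg g (funext fun z => propext (and_congr_right fun hz => ?_))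
    exact (hC z).mono (Finset.le_sup hz) hxy
  · have hsub : {x | f x ≠ g fun z => z ∈ R ∧ x ∈ C z} ⊆ ⋃ z ∈ R, symmDiff (C z) (f ⁻¹' {z}) := by
      intro x hx
      by_contra hx'
      refine hx (hg _ _ fun w => ?_).symm
      simp only [Set.mem_iUnion, not_exists, Set.mem_symmDiff, not_or, not_and_not_right,
        Set.mem_preimage, Set.mem_singleton_iff] at hx'
      constructor
      · rintro ⟨h1, h2⟩
        exact ((hx' w h1).1 h2).symm
      · rintro rfl
        exact ⟨hR x, (hx' _ (hR x)).2 rfl⟩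
    calc ν.real {x | f x ≠ g fun z => z ∈ R ∧ x ∈ C z}
        ≤ ν.real (⋃ z ∈ R, symmDiff (C z) (f ⁻¹' {z})) := measureReal_mono hsub (measure_ne_top _ _)
      _ ≤ ∑ z ∈ R, ν.real (symmDiff (C z) (f ⁻¹' {z})) := measureReal_biUnion_finset_le _ _
      _ ≤ R.card • (ε / (R.card + 1)) := Finset.sum_le_card_nsmul _ _ _ fun z _ => (hlt z).le
      _ < ε := by
        rw [nsmul_eq_mul, mul_div_assoc', div_lt_iff₀ (by positivity)]
        nlinarith

/-! ### Approximation of eigenfunctions along the towers -/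

/-- The function that takes the value `lam⁻¹ ^ j * c t` at position `j` of tower `t`. -/
noncomputable def towerwise (q : ℕ → ℕ) (lam : ℂ) {n : ℕ} (c : B.V n → ℂ) (x : B.PathSpace) : ℂ :=
  lam⁻¹ ^ x.index q 0 n * c (x.tower n)

theorem measurable_towerwise {n : ℕ} (c : B.V n → ℂ) : Measurable (towerwise q lam c) :=
  measurable_of_determinedAt (n := n) fun x y h => by
    rw [towerwise, towerwise, tower_eq_of_initial h, PathSpace.index_congr q fun i _ hi => h i hi]

/-- Floor `j + 1` is the preimage of floor `j`, and `f` gains a factor λ under T, so the error of a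
towerwise constant is the same on all floors. -/
theorem measureReal_mul_ne_inter_floor [IsFiniteMeasure ν] (hq : B.IsToeplitz q)
    (hν : MeasurePreserving (vershik hB) ν ν) {f : B.PathSpace → ℂ}
    (hf : Measurable f) (hfT : ∀ᵐ x ∂ν, f (vershik hB x) = lam * f x) {n j : ℕ} (t : B.V n) (c : ℂ)
    (hj : j < qProd q 0 n) :
    ν.real ({x | lam ^ j * f x ≠ c} ∩ floor q t j) = ν.real ({x | f x ≠ c} ∩ floor q t 0) := by
  induction j with
  | zero => simp
  | succ j ih =>
    have hm : MeasurableSet ({x | lam ^ j * f x ≠ c} ∩ floor q t j) :=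
      ((measurableSet_eq_fun (hf.const_mul _) measurable_const).compl).inter
        (determinedAt_floor q t j).measurableSet
    rw [← ih (by omega), ← hν.measureReal_preimage hm.nullMeasurableSet, Set.preimage_inter,
      preimage_floor hB hq t hj]
    refine measureReal_congr ?_
    filter_upwards [hfT] with x hx
    refine propext (and_congr_left fun _ => ?_)
    change lam ^ (j + 1) * f x ≠ c ↔ lam ^ j * f (vershik hB x) ≠ c
    rw [hx, pow_succ, mul_assoc]

/-- On each tower the constant is taken from the floor where `h` is most accurate. Transported along
the tower, it has that minimal error on every floor. -/
theorem exists_towerwise_of_determined [IsFiniteMeasure ν] (hq : B.IsToeplitz q)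
    (hν : MeasurePreserving (vershik hB) ν ν) (h0 : lam ≠ 0) {f h : B.PathSpace → ℂ}
    (hf : Measurable f) (hfT : ∀ᵐ x ∂ν, f (vershik hB x) = lam * f x) {n : ℕ}
    (hh : ∀ x y : B.PathSpace, (∀ i < n, x.1 i = y.1 i) → h x = h y) :
    ∃ c : B.V n → ℂ, ν.real {x | f x ≠ towerwise q lam c x} ≤ ν.real {x | f x ≠ h x} := by
  have hm : MeasurableSet {x | f x ≠ h x} :=
    (measurableSet_eq_fun hf (measurable_of_determinedAt hh)).compl
  have key : ∀ t : B.V n, ∃ c : ℂ, ∀ i < qProd q 0 n,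
      ν.real ({x | lam ^ i * f x ≠ c} ∩ floor q t i) ≤ ν.real ({x | f x ≠ h x} ∩ floor q t i) := by
    intro t
    obtain ⟨j, hj, hmin⟩ := Finset.exists_min_image (Finset.range (qProd q 0 n))
      (fun j => ν.real ({x | f x ≠ h x} ∩ floor q t j))
      (Finset.nonempty_range_iff.2 (hq.qProd_pos 0 n).ne')
    rw [Finset.mem_range] at hj
    obtain ⟨y, hy⟩ := exists_tower_eq_index_eq hq (Nat.zero_le n) t hj
    refine ⟨lam ^ j * h y, fun i hi => ?_⟩
    rw [measureReal_mul_ne_inter_floor hq hν hf hfT t _ hi,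
      ← measureReal_mul_ne_inter_floor hq hν hf hfT t _ hj]
    refine le_trans (le_of_eq ?_) (hmin i (Finset.mem_range.2 hi))
    congr 1
    ext x
    refine and_congr_left fun hx => ?_
    change lam ^ j * f x ≠ lam ^ j * h y ↔ f x ≠ h x
    rw [hh x y (initial_eq_of_mem_floor hq hx hy), Ne, mul_right_inj' (pow_ne_zero _ h0)]
  choose c hc using key
  refine ⟨c, ?_⟩
  have hm' : MeasurableSet {x | f x ≠ towerwise q lam c x} :=
    (measurableSet_eq_fun hf (measurable_towerwise c)).compl
  rw [← sum_measureReal_tower ν n hm', ← sum_measureReal_tower ν n hm]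
  refine Finset.sum_le_sum fun t _ => ?_
  rw [← sum_measureReal_floor hq ν t hm', ← sum_measureReal_floor hq ν t hm]
  refine Finset.sum_le_sum fun i hi => le_trans (le_of_eq ?_) (hc t i (Finset.mem_range.1 hi))
  congr 1
  ext x
  refine and_congr_left fun hx => not_congr ?_
  rw [towerwise, hx.1, hx.2, inv_pow, eq_inv_mul_iff_mul_eq₀ (pow_ne_zero _ h0)]

theorem exists_towerwise [IsFiniteMeasure ν] (hq : B.IsToeplitz q)
    (hν : MeasurePreserving (vershik hB) ν ν) (h0 : lam ≠ 0) {f : B.PathSpace → ℂ}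
    (hf : Measurable f) (R : Finset ℂ) (hR : ∀ x, f x ∈ R)
    (hfT : ∀ᵐ x ∂ν, f (vershik hB x) = lam * f x) {ε : ℝ} (hε : 0 < ε) :
    ∃ N, ∀ n ≥ N, ∃ c : B.V n → ℂ, ν.real {x | f x ≠ towerwise q lam c x} < ε := by
  obtain ⟨N, h, hh, hlt⟩ := exists_determined_function (ν := ν) hf R hR hε
  refine ⟨N, fun n hn => ?_⟩
  obtain ⟨c, hc⟩ := exists_towerwise_of_determined hq hν h0 hf hfT (n := n)
    fun x y hxy => hh x y fun i hi => hxy i (hi.trans_le hn)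
  exact ⟨c, hc.trans_lt hlt⟩

/-- At a mismatched position the two towerwise functions differ, so `f` differs from one of them;
all positions in the tower have equal mass. -/
theorem card_mismatches_mul_le [IsFiniteMeasure ν] (hq : B.IsToeplitz q)
    (hν : MeasurePreserving (vershik hB) ν ν) (h0 : lam ≠ 0) {f : B.PathSpace → ℂ} {m n : ℕ}
    (h : m ≤ n) {c : B.V m → ℂ} {c' : B.V n → ℂ} {ε : ℝ}
    (hc : ν.real {x | f x ≠ towerwise q lam c x} ≤ ε)
    (hc' : ν.real {x | f x ≠ towerwise q lam c' x} ≤ ε) (t : B.V n) :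
    (mismatches (qProd q m n) (vertexAt q m t) (lam ^ qProd q 0 m)⁻¹ (c' t) c).card
      * ν.real {x | x.tower n = t} ≤ 2 * ε * qProd q m n := by
  have hp : (0 : ℝ) < qProd q m n := by exact_mod_cast hq.qProd_pos m n
  set M := mismatches (qProd q m n) (vertexAt q m t) (lam ^ qProd q 0 m)⁻¹ (c' t) c
  have hM : M ⊆ Finset.range (qProd q m n) := Finset.filter_subset _ _
  rw [← div_le_iff₀ hp, mul_div_assoc, ← measureReal_index_mem hq hν h t hM]
  have hsub : {x : B.PathSpace | x.tower n = t ∧ x.index q m n ∈ M}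
      ⊆ {x | f x ≠ towerwise q lam c x} ∪ {x | f x ≠ towerwise q lam c' x} := by
    rintro x ⟨rfl, hx⟩
    rw [mem_mismatches, vertexAt_tower hq h] at hx
    by_contra hx'
    simp only [Set.mem_union, Set.mem_ofPred_eq, not_or, not_not] at hx'
    have h1 := hx'.1.symm.trans hx'.2
    rw [towerwise, towerwise, PathSpace.index_add q (Nat.zero_le m) h, pow_add, mul_assoc,
      mul_right_inj' (pow_ne_zero _ (inv_ne_zero h0)), pow_mul, inv_pow] at h1
    exact hx.2 (by rw [h1, mul_comm])
  calc _ ≤ _ := measureReal_mono hsub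
    _ ≤ _ := measureReal_union_le _ _
    _ ≤ _ := by linarith

end OrderedBratteliDiagram

namespace OrderedBratteliDiagram

variable {B : OrderedBratteliDiagram} {q : ℕ → ℕ} {hB : B.IsProperlyOrdered}
  {ν : Measure B.PathSpace} {d : ℕ} {lam : ℂ}

/-! ### Eigenvalues and suffix sums -/

theorem IsProper.le_qProd (hp : B.IsProper d) (hq : B.IsToeplitz q) {m n : ℕ} (hm : 2 ≤ m)
    (h : m < n) : d ≤ qProd q m (m + 1) ∧ qProd q m (m + 1) ≤ qProd q m n := by
  constructor
  · rw [qProd_succ q le_rfl, qProd_self, one_mul]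
    exact hp.le_of_isToeplitz hq hm
  · rw [← qProd_mul q m.le_succ h]
    exact Nat.le_mul_of_pos_right _ (hq.qProd_pos _ _)

theorem vertexAt_zero_eq (hp : B.IsProper d) (hq : B.IsToeplitz q) {m : ℕ} (hm : 1 ≤ m)
    (t t' : B.V (m + 1)) : vertexAt q m t 0 = vertexAt q m t' 0 := by
  obtain ⟨x, rfl, hx⟩ := exists_tower_eq_index_eq hq m.le_succ t (hq.qProd_pos m (m + 1))
  obtain ⟨y, rfl, hy⟩ := exists_tower_eq_index_eq hq m.le_succ t' (hq.qProd_pos m (m + 1))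
  conv_lhs => rw [← hx, vertexAt_tower hq m.le_succ]
  conv_rhs => rw [← hy, vertexAt_tower hq m.le_succ]
  rw [PathSpace.index_eq_zero_iff hq] at hx hy
  exact hp.h4 m hm _ _ (hx m le_rfl m.lt_succ_self) (hy m le_rfl m.lt_succ_self)

/-- The towers with `c t ≠ 0` carry more than half of `α`, and there are at most d of them. -/
theorem exists_ne_zero_of_towerwise [IsProbabilityMeasure ν] (hd : 0 < d) {f : B.PathSpace → ℂ}
    {n : ℕ} (hn : Fintype.card (B.V n) = d) {c : B.V n → ℂ} {α : ℝ} (hα : 0 < α)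
    (hfα : α ≤ ν.real {x | f x ≠ 0}) (hc : ν.real {x | f x ≠ towerwise q lam c x} < α / 2) :
    ∃ t, c t ≠ 0 ∧ α / (2 * d) ≤ ν.real {x | x.tower n = t} := by
  by_contra! hcon
  have hd' : (0 : ℝ) < d := by exact_mod_cast hd
  have h1 : ν.real {x | c (x.tower n) ≠ 0} ≤ α / 2 := by
    rw [← sum_measureReal_tower ν n (determinedAt_tower fun t => c t ≠ 0).measurableSet]
    refine (Finset.sum_le_card_nsmul _ _ (α / (2 * d)) fun t _ => ?_).trans_eq ?_
    · by_cases ht : c t = 0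
      · have : {x : B.PathSpace | c (x.tower n) ≠ 0} ∩ {x | x.tower n = t} = ∅ := by
          ext x
          simp only [Set.mem_inter_iff, Set.mem_ofPred_eq, Set.mem_empty_iff_false, iff_false,
            not_and]
          rintro hx rfl
          exact hx ht
        rw [this, measureReal_empty]
        positivity
      · exact (measureReal_mono Set.inter_subset_right).trans (hcon t ht).le
    · rw [Finset.card_univ, hn, nsmul_eq_mul]
      field_simp
  have h2 : {x | f x ≠ 0} ⊆ {x | f x ≠ towerwise q lam c x} ∪ {x | c (x.tower n) ≠ 0} := by
    intro x hx
    by_contra hx'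
    simp only [Set.mem_union, Set.mem_ofPred_eq, not_or, not_not] at hx'
    exact hx (by rw [hx'.1, towerwise, hx'.2, mul_zero])
  have h3 := (measureReal_mono h2 (measure_ne_top ν _)).trans (measureReal_union_le _ _)
  linarith

theorem two_mul_card_mismatches_lt [IsFiniteMeasure ν] (hd : 0 < d) (hq : B.IsToeplitz q)
    (hν : MeasurePreserving (vershik hB) ν ν) (h0 : lam ≠ 0) {f : B.PathSpace → ℂ} {m n : ℕ}
    (h : m ≤ n) {c : B.V m → ℂ} {c' : B.V n → ℂ} {ε β : ℝ} (hβ : 0 < β)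
    (hεβ : 4 * d * ε < β) (hc : ν.real {x | f x ≠ towerwise q lam c x} ≤ ε)
    (hc' : ν.real {x | f x ≠ towerwise q lam c' x} ≤ ε) {t : B.V n}
    (ht : β ≤ ν.real {x | x.tower n = t}) :
    2 * d * (mismatches (qProd q m n) (vertexAt q m t) (lam ^ qProd q 0 m)⁻¹ (c' t) c).card
      < qProd q m n := by
  have hp : (0 : ℝ) < qProd q m n := by exact_mod_cast hq.qProd_pos m n
  have hd' : (0 : ℝ) < d := by exact_mod_cast hd
  have h1 := card_mismatches_mul_le hq hν h0 h hc hc' t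
  set k := (mismatches (qProd q m n) (vertexAt q m t) (lam ^ qProd q 0 m)⁻¹ (c' t) c).card
  have h2 : (k : ℝ) * β ≤ 2 * ε * qProd q m n :=
    (mul_le_mul_of_nonneg_left ht (Nat.cast_nonneg _)).trans h1
  have h3 : (2 * d * k : ℝ) * β < qProd q m n * β := by
    calc (2 * d * k : ℝ) * β = 2 * d * (k * β) := by ring
      _ ≤ 2 * d * (2 * ε * qProd q m n) := by gcongr
      _ = 4 * d * ε * qProd q m n := by ring
      _ < β * qProd q m n := by gcongr
      _ = _ := mul_comm _ _
  exact_mod_cast lt_of_mul_lt_mul_right h3 hβ.le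

theorem suffixSumsConverge_of_isMeasurableEigenvalue [IsProbabilityMeasure ν] (hd : 2 ≤ d)
    (hq : B.IsToeplitz q) (hp : B.IsProper d) (hν : MeasurePreserving (vershik hB) ν ν)
    {k : ℕ} (hk : k ≠ 0) (hlamk : lam ^ k = 1)
    (hprim : ∀ᶠ n in atTop, IsPrimitiveRoot (lam ^ qProd q 0 n) d)
    (hE : IsMeasurableEigenvalue (vershik hB) ν lam) : SuffixSumsConverge B q lam d := by
  classical
  have hd0 : 0 < d := by omega
  have hd' : (0 : ℝ) < d := by exact_mod_cast hd0
  have h0 : lam ≠ 0 := fun h => by simp [h, hk] at hlamk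
  obtain ⟨f, hf, hroot, hα, hfT⟩ := hE.exists_root_valued hν hk hlamk
  set α := ν.real {x | f x ≠ 0}
  obtain ⟨R, hR⟩ : ∃ R : Finset ℂ, ∀ x, f x ∈ R := by
    refine ⟨insert 0 (Polynomial.nthRoots k (1 : ℂ)).toFinset, fun x => ?_⟩
    rcases hroot x with h | h
    · simp [h]
    · exact Finset.mem_insert_of_mem
        (by simpa [Polynomial.mem_nthRoots (Nat.pos_of_ne_zero hk)] using h)
  have happrox := fun ε (hε : (0 : ℝ) < ε) => exists_towerwise hq hν h0 hf R hR hfT hε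
  obtain ⟨M, hM⟩ := eventually_atTop.1 hprim
  have hω : ∀ m ≥ M, IsPrimitiveRoot (lam ^ qProd q 0 m)⁻¹ d := fun m hm => (hM m hm).inv
  -- a uniform lower bound for the measures of the towers
  set ε₁ := α / (16 * d * d) with hε₁
  set δ := α / (8 * d * d) with hδ
  have hε₁pos : 0 < ε₁ := by positivity
  have hδpos : 0 < δ := by positivity
  have hε₁α : ε₁ < α / 2 := by
    rw [hε₁]
    refine div_lt_div_of_pos_left hα two_pos ?_
    have : (2 : ℝ) ≤ d := by exact_mod_cast hd
    nlinarith
  have hεβ : 4 * d * ε₁ < α / (2 * d) := by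
    have : 4 * d * ε₁ = α / (2 * d) / 2 := by
      rw [hε₁]
      field_simp
      norm_num
    rw [this]
    exact half_lt_self (by positivity)
  obtain ⟨N₁, hN₁⟩ := happrox ε₁ hε₁pos
  -- One tower of level `m + 1` that is heavy and has a nonzero constant controls all vertices of
  -- level `m`.
  have step : ∀ m, N₁ ≤ m → M ≤ m → 2 ≤ m → ∀ c : B.V m → ℂ,
      ν.real {x | f x ≠ towerwise q lam c x} ≤ ε₁ → Function.Injective c ∧ (∀ t, c t ≠ 0) ∧
        ∀ t : B.V m, δ ≤ ν.real {x | x.tower m = t} := by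
    intro m hmN hmM hm2 c hc
    obtain ⟨c', hc'⟩ := hN₁ (m + 1) (by omega)
    obtain ⟨t₂, ht₂, hβ⟩ := exists_ne_zero_of_towerwise hd0 (hp.card_V (by omega)) hα le_rfl
      (hc'.trans hε₁α)
    have hbad := two_mul_card_mismatches_lt hd0 hq hν h0 m.le_succ (by positivity) hεβ hc hc'.le hβ
    have hQ := (hp.le_qProd hq hm2 m.lt_succ_self).1
    obtain ⟨h1, h2⟩ := injective_of_mismatches hd0 (hp.card_V hm2) (hω m hmM) ht₂ hQ hbad
    refine ⟨h1, h2, fun t => ?_⟩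
    have h3 := le_card_of_mismatches hd0 (hp.card_V hm2) (hω m hmM) ht₂ hQ hbad
      (A := positions q t t₂) (t := t) (fun s => mem_positions)
    have h4 := card_mismatches_mul_le hq hν h0 m.le_succ hc hc'.le t₂
    set K := (mismatches (qProd q m (m + 1)) (vertexAt q m t₂) (lam ^ qProd q 0 m)⁻¹ (c' t₂) c).card
    have hQpos : (0 : ℝ) < qProd q m (m + 1) := by exact_mod_cast hq.qProd_pos m (m + 1)
    have h5 : (K : ℝ) * (α / (2 * d)) ≤ 2 * ε₁ * qProd q m (m + 1) :=
      (mul_le_mul_of_nonneg_left hβ (Nat.cast_nonneg _)).trans h4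
    have h6 : (K : ℝ) ≤ qProd q m (m + 1) / (4 * d) := by
      have : (qProd q m (m + 1) : ℝ) / (4 * d) * (α / (2 * d)) = 2 * ε₁ * qProd q m (m + 1) := by
        rw [hε₁]
        field_simp
        norm_num
      rw [← this] at h5
      exact le_of_mul_le_mul_right h5 (by positivity)
    have h7 : (qProd q m (m + 1) : ℝ) / (4 * d) ≤ (positions q t t₂).card := by
      have h8 : (qProd q m (m + 1) : ℝ) ≤ 2 * d * ((positions q t t₂).card + K) := by
        exact_mod_cast h3
      have h9 : (qProd q m (m + 1) : ℝ) / (2 * d) ≤ (positions q t t₂).card + K := by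
        rw [div_le_iff₀ (by positivity)]
        linarith
      have h10 : (qProd q m (m + 1) : ℝ) / (2 * d)
          = qProd q m (m + 1) / (4 * d) + qProd q m (m + 1) / (4 * d) := by
        field_simp
        norm_num
      linarith
    calc δ = qProd q m (m + 1) / (4 * d) * (α / (2 * d) / qProd q m (m + 1)) := by
          rw [hδ]
          field_simp
          norm_num
      _ ≤ (positions q t t₂).card * (ν.real {x | x.tower (m + 1) = t₂} / qProd q m (m + 1)) := by
          gcongr
      _ = ν.real ({x | x.tower m = t} ∩ {x | x.tower (m + 1) = t₂}) :=
          (measureReal_tower_inter hq hν m.le_succ t t₂).symm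
      _ ≤ _ := measureReal_mono Set.inter_subset_left
  intro ε hε
  -- The total error, mismatches plus 1, will be at most 2ηQ < εQ; the bound 1/(4d) makes the
  -- residue-class lemmas applicable.
  set η := min (ε / 3) (1 / (4 * d)) with hη
  have hηpos : 0 < η := by positivity
  have hηε : 2 * η < ε := by
    have : η ≤ ε / 3 := min_le_left _ _
    linarith
  set ε₂ := min ε₁ (δ * η / 2) with hε₂
  have hε₂pos : 0 < ε₂ := by positivity
  obtain ⟨N₂, hN₂⟩ := happrox ε₂ hε₂pos
  have hmis : ∀ m n, m < n → N₁ ≤ m → M ≤ m → 2 ≤ m → ∀ (c : B.V m → ℂ) (c' : B.V n → ℂ),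
      ν.real {x | f x ≠ towerwise q lam c x} ≤ ε₂ → ν.real {x | f x ≠ towerwise q lam c' x} ≤ ε₂ →
      ∀ t : B.V n,
        ((mismatches (qProd q m n) (vertexAt q m t) (lam ^ qProd q 0 m)⁻¹ (c' t) c).card : ℝ)
          ≤ η * qProd q m n := by
    intro m n hmn hmN hmM hm2 c c' hc hc' t
    have h1 := card_mismatches_mul_le hq hν h0 hmn.le hc hc' t
    have h2 := (step n (by omega) (by omega) (by omega) c' (hc'.trans (min_le_left _ _))).2.2 t
    set K := (mismatches (qProd q m n) (vertexAt q m t) (lam ^ qProd q 0 m)⁻¹ (c' t) c).card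
    have h3 : (K : ℝ) * δ ≤ η * qProd q m n * δ := by
      calc (K : ℝ) * δ ≤ K * ν.real {x | x.tower n = t} := by gcongr
        _ ≤ 2 * ε₂ * qProd q m n := h1
        _ ≤ 2 * (δ * η / 2) * qProd q m n := by gcongr; exact min_le_right _ _
        _ = _ := by ring
    exact le_of_mul_le_mul_right h3 hδpos
  refine ⟨N₁ + N₂ + M + 2, fun m n hm hmn t₁ t₂ => ?_⟩
  obtain ⟨c, hc⟩ := hN₂ m (by omega)
  obtain ⟨c', hc'⟩ := hN₂ n (by omega)
  obtain ⟨c₁, hc₁⟩ := hN₂ (m + 1) (by omega)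
  obtain ⟨hQ, hQ'⟩ := hp.le_qProd hq (show 2 ≤ m by omega) hmn
  have hQpos : (0 : ℝ) < qProd q m n := by exact_mod_cast hq.qProd_pos m n
  -- the number of edges is large because all maximal edges start in the same vertex
  have hone : 1 ≤ η * qProd q m n := by
    obtain ⟨hinj, -, -⟩ := step (m + 1) (by omega) (by omega) (by omega) c₁
      (hc₁.le.trans (min_le_left _ _))
    have hcard : 1 < Fintype.card (B.V (m + 1)) := by rw [hp.card_V (by omega)]; omega
    obtain ⟨t, t', htt⟩ := Fintype.exists_pair_of_one_lt_card hcard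
    -- Position 0 lies over the same vertex for every `u`. Without a mismatch there, `c₁` would be
    -- constant, against its injectivity on d ≥ 2 vertices. So 1 is itself bounded by a number of
    -- mismatches.
    have hmem : ∃ u : B.V (m + 1), 0 ∈ mismatches (qProd q m (m + 1)) (vertexAt q m u)
        (lam ^ qProd q 0 m)⁻¹ (c₁ u) c := by
      by_contra! hcon
      simp only [mem_mismatches, not_and_not_right, pow_zero, mul_one] at hcon
      have hpos := hq.qProd_pos m (m + 1)
      exact htt (hinj (by
        rw [hcon t hpos, hcon t' hpos, vertexAt_zero_eq hp hq (by omega) t t']))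
    obtain ⟨u, hu⟩ := hmem
    have h1 := hmis m (m + 1) m.lt_succ_self (by omega) (by omega) (by omega) c c₁ hc.le hc₁.le u
    have h2 : (1 : ℝ) ≤ (mismatches (qProd q m (m + 1)) (vertexAt q m u)
        (lam ^ qProd q 0 m)⁻¹ (c₁ u) c).card := by
      exact_mod_cast Finset.card_pos.2 ⟨0, hu⟩
    exact (h2.trans h1).trans (by gcongr)
  have hbadη := hmis m n hmn (by omega) (by omega) (by omega) c c' hc.le hc'.le t₂
  have hbad : 2 * d * (mismatches (qProd q m n) (vertexAt q m t₂)
      (lam ^ qProd q 0 m)⁻¹ (c' t₂) c).card < qProd q m n := by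
    have h1 : η * qProd q m n ≤ 1 / (4 * d) * qProd q m n := by
      gcongr
      exact min_le_right _ _
    have h2 : (2 * d * (mismatches (qProd q m n) (vertexAt q m t₂)
        (lam ^ qProd q 0 m)⁻¹ (c' t₂) c).card : ℝ) ≤ 2 * d * (1 / (4 * d) * qProd q m n) := by
      gcongr
      exact hbadη.trans h1
    have h3 : 2 * (d : ℝ) * (1 / (4 * d) * qProd q m n) = qProd q m n / 2 := by
      field_simp
      norm_num
    rw [h3] at h2
    exact_mod_cast h2.trans_lt (half_lt_self hQpos)
  have hne := (step n (by omega) (by omega) (by omega) c' (hc'.le.trans (min_le_left _ _))).2.1 t₂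
  have h1 := abs_norm_sum_sub_le_of_mismatches hd0 (hp.card_V (by omega)) (hω m (by omega)) hne
    (hQ.trans hQ') hbad (A := positions q t₁ t₂) (t := t₁) (fun s => mem_positions)
  rw [← suffixSum_eq hq lam hmn.le] at h1
  have h2 : ‖suffixSum q lam hmn.le t₁ t₂‖ / (qProd q m n : ℝ) - 1 / d
      = (‖suffixSum q lam hmn.le t₁ t₂‖ - (qProd q m n : ℝ) / d) / qProd q m n := by
    field_simp
  rw [h2, abs_div, abs_of_pos hQpos, div_lt_iff₀ hQpos]
  nlinarith

end OrderedBratteliDiagram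

/-! ### The theorem. -/

theorem mainTheorem6 (d : ℕ) (hd : 2 ≤ d) (B : OrderedBratteliDiagram)
    (hB : B.IsProperlyOrdered) (hproper : B.IsProper d)
    (q : ℕ → ℕ) (hq : B.IsToeplitz q)
    (μ : Measure B.PathSpace) [IsProbabilityMeasure μ]
    (hμ : MeasurePreserving (OrderedBratteliDiagram.vershik hB) μ μ)
    (a b : ℤ) (hab : IsCoprime a b)
    (hb : ∀ᶠ n : ℕ in atTop,
      b / (Int.gcd b (OrderedBratteliDiagram.qProd q 0 n : ℤ) : ℤ) = (d : ℤ))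
    (lam : ℂ) (hlam : lam = Complex.exp (2 * Complex.I * Real.pi * (a / b))) :
    (IsNonContinuousEigenvalue (OrderedBratteliDiagram.vershik hB) μ lam ↔
      ∀ ε > (0 : ℝ), ∃ N : ℕ, ∀ (m n : ℕ) (_ : N ≤ m) (hmn : m < n) (t₁ : B.V m) (t₂ : B.V n),
        |‖OrderedBratteliDiagram.suffixSum q lam hmn.le t₁ t₂‖
            / (OrderedBratteliDiagram.qProd q m n : ℝ) - 1 / (d : ℝ)| < ε) ∧
    (IsMeasurableEigenvalue (OrderedBratteliDiagram.vershik hB) μ lam →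
      (∀ ν : Measure B.PathSpace, IsProbabilityMeasure ν →
        MeasurePreserving (OrderedBratteliDiagram.vershik hB) ν ν → ν = μ) ∧
      ∀ t : (n : ℕ) → B.V n,
        Tendsto (fun n => μ.real {x | x.tower n = t n}) atTop (𝓝 (1 / (d : ℝ)))) := by
  obtain ⟨k, hk, hlamk, hprim⟩ :=
    OrderedBratteliDiagram.exists_isPrimitiveRoot_pow_qProd hq (by omega) hab hb hlam
  have hnorm : ‖lam‖ = 1 := Complex.norm_eq_one_of_pow_eq_one hlamk hk
  have hconv := OrderedBratteliDiagram.suffixSumsConverge_of_isMeasurableEigenvalue hd hq hproper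
    hμ hk hlamk hprim
  refine ⟨⟨fun h => hconv h.1, fun h => ⟨?_, ?_⟩⟩, fun h => ⟨fun ν hν hνT => ?_, fun t => ?_⟩⟩
  · exact OrderedBratteliDiagram.isMeasurableEigenvalue_of_suffixSumsConverge hd hq hproper hμ
      hnorm h
  · exact OrderedBratteliDiagram.not_isContinuousEigenvalue hd hq hproper hnorm hprim
  · exact OrderedBratteliDiagram.invariant_unique hq hproper hνT hμ hnorm (hconv h)
  · exact OrderedBratteliDiagram.tendsto_measureReal_tower hq hproper hμ hnorm (hconv h) t
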